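/- Notation. On $\mathbb C^3$ let $g=\sum_j|dz_j|^2$, $\omega=\frac i2\sum_j dz_j\wedge d\bar z_j$, $\Omega=dz_1\wedge dz_2\wedge dz_3$, and $$(r_1,r_2,r_3)\times(s_1,s_2,s_3)=\tfrac12(\bar r_2\bar s_3-\bar r_3\bar s_2,\ \bar r_3\bar s_1-\bar r_1\bar s_3,\ \bar r_1\bar s_2-\bar r_2\bar s_1).$$ An immersion of a $3$-manifold into $\mathbb C^3$ is special Lagrangian (SL) if, for a suitable orientation, $\mathrm{Re}\,\Omega$ restricts to the Riemannian volume form of $g$ on each tangent plane. Set $q_1(t)=(e^{it},ie^{-it},0)$ and $q_2(t)=(0,0,1)$. **Theorem.** Let $k\ge 3$, $A_1=A_2=0$ and $A_3,\dots,A_k,B_1,\dots,B_k\in\mathbb C$. There are unique differentiable curves $p_j=(a_j,b_j,c_j):\mathbb R\to\mathbb C^3$, $0\le j\le k$, such that for all $t\in\mathbb R$ $$p_0'=2p_1\times q_1,\quad p_j'=2(j+1)p_{j+1}\times q_1+2j\,p_j\times q_2\ (1\le j\le k-1),\quad p_k'=2k\,p_k\times q_2,$$ $$q_1'=-2q_1\times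 q_2,\quad q_2'=0,\quad \omega(q_1,q_2)=0,\quad \omega(p_k,q_2)=0,\quad j\,\omega(p_j,q_1)+(j-1)\,\omega(p_{j-1},q_2)=0\ (1\le j\le k),$$ and with the following constants of integration (Fourier coefficients over $[-\pi,\pi]$): for $1\le j\le k$ the coefficients of $e^{ijt}$ and $e^{-ijt}$ in $a_j$ are $A_j$ and $B_j$, and the constant term of $c_j$ is $0$; the constant terms of $a_0,b_0,c_0$ are $0$. Put $$\Phi(x,y,t)=p_0(t)+x\,p_1(t)+\dots+x^k p_k(t)+y\,q_1(t)+xy\,q_2(t),\qquad N=\Phi(\mathbb R^3)\subset\mathbb C^3 .$$ 1. For all values of the parameters, $\Phi:\mathbb R^3\to\mathbb C^3$ is smooth, $\Phi(x,y,t+2\pi)=\Phi(x,y,t)$ and $\Phi(x,y,t+\pi)=\Phi(-x,-y,t)$; the points at which $d\Phi$ is injective are dense in $\mathbb R^3$, and at all of them $\Phi$ is special Lagrangian. Thus the $N$ form a family of SL $3$-folds (possibly with singularities), depending on $A_3,\dots,A_k,B_1,\dots,B_k$, periodic in $t$. 2. Let $\mathbb Z$ act on $\mathbb R^3$ by $n\cdot(x,y,t)=((-1)^nx,(-1)^ny,t+n\pi)$.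 Then $\mathbb R^3/\mathbb Z$ is diffeomorphic to $S^1\times\mathbb R^2$, and for generic $(A_3,\dots,A_k,B_1,\dots,B_k)$ the set $N$ is closed in $\mathbb C^3$ and $\Phi$ descends to a proper special Lagrangian immersion $S^1\times\mathbb R^2\cong\mathbb R^3/\mathbb Z\to\mathbb C^3$ with image $N$; that is, $N$ is a closed, nonsingular, immersed $3$-submanifold diffeomorphic to $S^1\times\mathbb R^2$. Here generic means: for all parameters in an open dense subset of $\mathbb C^{k-2}\times\mathbb C^{k}\cong\mathbb R^{4k-4}$ whose complement has Hausdorff dimension at most $4k-5$ (real codimension at least one). -/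

import Mathlib

open scoped ContDiff Manifold ENNReal ComplexConjugate

noncomputable section

namespace SLFamily

/-- `ℂ³` with its standard Hermitian structure; the real metric is `g(u,v) = Re ⟨u,v⟩`. -/
abbrev C3 : Type := EuclideanSpace ℂ (Fin 3)

/-- The Kähler form `ω = (i/2) ∑ dz_j ∧ dz̄_j`, that is `ω(u,v) = Im ∑ conj(u_j) v_j`. -/
def kahlerForm (u v : C3) : ℝ := (∑ j, conj (u j) * v j).im

/-- The holomorphic volume form `Ω = dz₁ ∧ dz₂ ∧ dz₃`. -/
def holVol (v : Fin 3 → C3) : ℂ := (Matrix.of fun i j => v i j).det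

/-- The metric `g = |dz₁|² + |dz₂|² + |dz₃|²`. -/
def metric (u v : C3) : ℝ := (∑ j, conj (u j) * v j).re

/-- The 3-dimensional volume of the parallelepiped spanned by three vectors, for `g`
(square root of the Gram determinant). -/
def vol3 (v : Fin 3 → C3) : ℝ := Real.sqrt (Matrix.of fun i j => metric (v i) (v j)).det

/-- `T` is the derivative at a point of a special Lagrangian immersion of a 3-manifold into
`ℂ³`: it is injective, its domain has dimension 3, and for a suitable orientation of the image
plane, `Re Ω` restricts to the Riemannian volume form of the plane. For one of the two
orientations this says that `|Re Ω|` is the volume on every triple of tangent vectors. (When this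
holds at all points of an immersed 3-manifold, the pulled back form `Re Ω` vanishes nowhere, so
the pointwise orientations fit together to the one defined by that form.) -/
def IsSLTangent {V : Type*} [AddCommGroup V] [Module ℝ V] (T : V → C3) : Prop :=
  IsLinearMap ℝ T ∧ Module.finrank ℝ V = 3 ∧ Function.Injective T ∧
    ∀ v : Fin 3 → V, |(holVol fun i => T (v i)).re| = vol3 fun i => T (v i)

/-- The complex anti-bilinear cross product on `ℂ³`. -/
def cross (r s : C3) : C3 :=
  !₂[(1 / 2 : ℂ) * (conj (r 1) * conj (s 2) - conj (r 2) * conj (s 1)),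
     (1 / 2 : ℂ) * (conj (r 2) * conj (s 0) - conj (r 0) * conj (s 2)),
     (1 / 2 : ℂ) * (conj (r 0) * conj (s 1) - conj (r 1) * conj (s 0))]

/-- The evolution equations for `p_0, …, p_k, q_1, q_2 : ℝ → ℂ³`, together with the
conditions on `ω` that make the evolving surfaces isotropic. The curves are indexed by `ℕ`,
with `p_j = 0` for `j > k`. -/
structure IsEvolution (k : ℕ) (p : ℕ → ℝ → C3) (q₁ q₂ : ℝ → C3) : Prop where
  p_eq_zero : ∀ j, k < j → p j = 0
  deriv_p_zero : ∀ t, HasDerivAt (p 0) ((2 : ℝ) • cross (p 1 t) (q₁ t)) t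
  deriv_p_mid : ∀ j, 1 ≤ j → j < k → ∀ t, HasDerivAt (p j)
    ((2 * (j + 1) : ℝ) • cross (p (j + 1) t) (q₁ t) + (2 * j : ℝ) • cross (p j t) (q₂ t)) t
  deriv_p_top : ∀ t, HasDerivAt (p k) ((2 * k : ℝ) • cross (p k t) (q₂ t)) t
  deriv_q_one : ∀ t, HasDerivAt q₁ ((-2 : ℝ) • cross (q₁ t) (q₂ t)) t
  deriv_q_two : ∀ t, HasDerivAt q₂ 0 t
  omega_q : ∀ t, kahlerForm (q₁ t) (q₂ t) = 0
  omega_top : ∀ t, kahlerForm (p k t) (q₂ t) = 0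
  omega_mid : ∀ j : ℕ, 1 ≤ j → j ≤ k → ∀ t,
    j * kahlerForm (p j t) (q₁ t) + (j - 1 : ℝ) * kahlerForm (p (j - 1) t) (q₂ t) = 0

/-- `q₁(t) = (e^{it}, i e^{-it}, 0)`. -/
def q1 (t : ℝ) : C3 :=
  !₂[Complex.exp (Complex.I * t), Complex.I * Complex.exp (-(Complex.I * t)), 0]

/-- `q₂(t) = (0, 0, 1)`. -/
def q2 (_t : ℝ) : C3 := !₂[0, 0, 1]

/-- The coefficient of `e^{int}` in `f`, computed over the interval `[-π, π]`. -/
def coeff (f : ℝ → ℂ) (n : ℤ) : ℂ :=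
  (1 / (2 * Real.pi) : ℂ) *
    ∫ t in (-Real.pi)..Real.pi, Complex.exp (-(Complex.I * n * t)) * f t

/-- The constants of integration, with `p_j = (a_j, b_j, c_j)`: for `1 ≤ j ≤ k` the constants
`A_j` and `B_j` are the coefficients of `e^{ijt}` and `e^{-ijt}` in `a_j`, and the constant term
of `c_j` is zero; the additive constants in `p_0` are zero. -/
structure HasConstants (k : ℕ) (A B : ℕ → ℂ) (p : ℕ → ℝ → C3) : Prop where
  coeff_A : ∀ j : ℕ, 1 ≤ j → j ≤ k → coeff (fun t => p j t 0) j = A j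
  coeff_B : ∀ j : ℕ, 1 ≤ j → j ≤ k → coeff (fun t => p j t 0) (-j) = B j
  coeff_C : ∀ j : ℕ, 1 ≤ j → j ≤ k → coeff (fun t => p j t 2) 0 = 0
  coeff_zero : ∀ i, coeff (fun t => p 0 t i) 0 = 0

/-- The parameters `A_3, …, A_k` and `B_1, …, B_k` in `ℂ`. -/
abbrev Params (k : ℕ) : Type := (Finset.Icc 3 k → ℂ) × (Finset.Icc 1 k → ℂ)

/-- `A_j`, where `A_1 = A_2 = 0`. -/
def Params.A {k : ℕ} (c : Params k) (j : ℕ) : ℂ :=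
  if h : j ∈ Finset.Icc 3 k then c.1 ⟨j, h⟩ else 0

/-- `B_j`. -/
def Params.B {k : ℕ} (c : Params k) (j : ℕ) : ℂ :=
  if h : j ∈ Finset.Icc 1 k then c.2 ⟨j, h⟩ else 0

/-- `p_0, …, p_k` are the curves of the construction with constants
`A_1 = A_2 = 0`, `A_3, …, A_k`, `B_1, …, B_k`. -/
def IsMember (k : ℕ) (c : Params k) (p : ℕ → ℝ → C3) : Prop :=
  IsEvolution k p q1 q2 ∧ HasConstants k c.A c.B p

/-- `Φ(x,y,t) = p_0(t) + x p_1(t) + ⋯ + x^k p_k(t) + y q_1(t) + xy q_2(t)`. -/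
def Phi (k : ℕ) (p : ℕ → ℝ → C3) (z : ℝ × ℝ × ℝ) : C3 :=
  (∑ j ∈ Finset.range (k + 1), z.1 ^ j • p j z.2.2) + z.2.1 • q1 z.2.2 +
    (z.1 * z.2.1) • q2 z.2.2

/-- The action of `n ∈ ℤ` on `ℝ³`: `(x,y,t) ↦ ((-1)^n x, (-1)^n y, t + nπ)`. -/
def deck (n : ℤ) (z : ℝ × ℝ × ℝ) : ℝ × ℝ × ℝ :=
  ((-1) ^ n * z.1, (-1) ^ n * z.2.1, z.2.2 + n * Real.pi)

/-- The model `ℝ²`. -/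
abbrev E2 : Type := EuclideanSpace ℝ (Fin 2)

/-- The manifold `S¹ × ℝ²`. -/
abbrev SolidTorus : Type := Circle × E2

/-- The model with corners of `S¹ × ℝ²`. -/
abbrev torusModel :
    ModelWithCorners ℝ (EuclideanSpace ℝ (Fin 1) × E2) (ModelProd (EuclideanSpace ℝ (Fin 1)) E2) :=
  (𝓡 1).prod 𝓘(ℝ, E2)

/-- `proj : ℝ³ → S¹ × ℝ²` is a surjective local diffeomorphism (smooth with bijective
derivatives) whose fibres are the `ℤ`-orbits: it exhibits `S¹ × ℝ²` as the quotient manifold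
`ℝ³/ℤ`. -/
structure IsQuotientByDeck (proj : ℝ × ℝ × ℝ → SolidTorus) : Prop where
  smooth : ContMDiff 𝓘(ℝ, ℝ × ℝ × ℝ) torusModel ∞ proj
  bijective_mfderiv : ∀ z,
    Function.Bijective (mfderiv 𝓘(ℝ, ℝ × ℝ × ℝ) torusModel proj z)
  surjective : Function.Surjective proj
  fibres : ∀ z w, proj z = proj w ↔ ∃ n : ℤ, w = deck n z

/-- `F : S¹ × ℝ² → ℂ³` is a special Lagrangian immersion. -/
def IsSLImmersion (F : SolidTorus → C3) : Prop :=
  ContMDiff torusModel 𝓘(ℝ, C3) ∞ F ∧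
    ∀ m, IsSLTangent (V := TangentSpace torusModel m) (mfderiv torusModel 𝓘(ℝ, C3) F m)

end SLFamily

end

/-! Write p_j = (e^{it}(s_j + i h̄_j)/2, e^{-it}(h_j - i s̄_j)/2, ρ_j + iη_j). In these variables
the evolution equations split into two systems of the same shape, f_j' = i(j+τ)f_j + 2(j+1)g_{j+1}
and g_j' = -(j+1) Re f_{j+1}: one for (s,η) with τ = -1, one for (h,ρ) with τ = 1. Each is
triangular in j and is solved by modes: a leading level l oscillates freely at frequency l+τ and
drives the levels l-2, l-4, ... below it at that same frequency. The driven amplitudes satisfy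
`modeCoeff_rec`, which is solvable when no lower level resonates. For τ = -1 this fails at l = 1, 2,
hence A_1 = A_2 = 0. The s-modes have amplitude 2A_l, and the h-modes have the amplitude β_l that
gives the Fourier coefficient B_l. Uniqueness (`IsMember.unique`) is a downward induction on j.
Since the driven levels have the parity of l, p_j(t+π) = (-1)^j p_j(t), which gives both periods.

With X = ∂Φ/∂x and Y = ∂Φ/∂y, the evolution equations say exactly that ∂Φ/∂t = 2 X×Y, and the
conditions on ω say that ω(X,Y) = 0. Such a frame spans a special Lagrangian plane as soon as X is
not a real multiple of Y (`abs_holVol_re_eq_vol3_of_frame`, `frame_injective`). On each line in the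
y-direction this fails at most once, so the immersed points are dense.

If X = rY for some real r, then Re ∂s/∂x = Re ∂h/∂x = ∂η/∂x = 0. These are three real equations,
linear in the parameters and independent of y, so they involve only the two variables (x,t). They
are independent for x ≠ 0; at x = 0 two of them are independent and only t varies; at x = ∞ they
force A_k = 0, of real codimension 2. Hence the bad parameters have codimension at least one
(`dimH_kernels_le`), and compactifying the x-line makes the set of parameters with a degeneration
closed.

The quotient ℝ³/ℤ is S¹×ℝ² by (x,y,t) ↦ (e^{2it}, the rotation of (x,y) by t). If A_k ≠ 0, the
leading term x^k p_k can be cancelled in the first two coordinates only by y q_1, and then xy q_2 is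
too large in the third. So Φ is proper on the quotient (`exists_bound_of_norm_Phi_le`), and its
image is closed. -/

noncomputable section

namespace SLFamily

/-! ### Modes of the system f_j' = i(j+τ)f_j + 2(j+1)g_{j+1}, g_j' = -(j+1) Re f_{j+1} -/

/-- The coefficients of a mode, indexed by the number of levels below the leading one. -/
def descent (τ : ℝ) (l : ℕ) : ℕ → ℝ
  | 0 => 1
  | 1 => 0
  | i + 2 => 2 * (((l - (i + 2) : ℕ) : ℝ) + 1) * (((l - (i + 2) : ℕ) : ℝ) + 2) /
      ((l + τ) ^ 2 - (((l - (i + 2) : ℕ) : ℝ) + τ) ^ 2) * descent τ l i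

/-- The coefficient at level `j` of the mode with leading level `l`. -/
def modeCoeff (τ : ℝ) (l j : ℕ) : ℝ := if j ≤ l then descent τ l (l - j) else 0

/-- No level below `l` resonates with the frequency `l + τ`. -/
structure NonResonant (τ : ℝ) (l : ℕ) : Prop where
  freq_ne : (l : ℝ) + τ ≠ 0
  sq_ne : ∀ j : ℕ, j + 2 ≤ l → ((l : ℝ) + τ) ^ 2 - (j + τ) ^ 2 ≠ 0

/-- The bound 3 is sharp: for l = 1 the frequency l-1 is zero, and for l = 2 it resonates with level
0, because (2-1)² = (0-1)². -/
lemma nonResonant_neg_one {l : ℕ} (hl : 3 ≤ l) : NonResonant (-1) l := by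
  have h3 : (3 : ℝ) ≤ l := by exact_mod_cast hl
  refine ⟨by linarith, fun j hj => ?_⟩
  have hj' : (j : ℝ) + 2 ≤ l := by exact_mod_cast hj
  have hj0 : (0 : ℝ) ≤ j := by positivity
  have : 0 < ((l : ℝ) - j) * (l + j - 2) := by
    apply mul_pos <;> linarith
  nlinarith

lemma nonResonant_one (l : ℕ) : NonResonant 1 l := by
  refine ⟨by positivity, fun j hj => ?_⟩
  have hj' : (j : ℝ) + 2 ≤ l := by exact_mod_cast hj
  have hj0 : (0 : ℝ) ≤ j := by positivity
  have : 0 < ((l : ℝ) - j) * (l + j + 2) := by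
    apply mul_pos <;> linarith
  nlinarith

@[simp] lemma modeCoeff_self (τ : ℝ) (l : ℕ) : modeCoeff τ l l = 1 := by
  simp [modeCoeff, descent]

lemma modeCoeff_of_lt {τ : ℝ} {l j : ℕ} (h : l < j) : modeCoeff τ l j = 0 := by
  simp [modeCoeff, Nat.not_le.2 h]

lemma descent_odd (τ : ℝ) (l i : ℕ) : descent τ l (2 * i + 1) = 0 := by
  induction i with
  | zero => simp [descent]
  | succ i ih =>
    rw [show 2 * (i + 1) + 1 = 2 * i + 1 + 2 by ring, descent, ih, mul_zero]

/-- Level j is driven only by level j+2, so a mode lives on levels of one parity. This is the source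
of the symmetry under t ↦ t + π. -/
lemma exists_of_modeCoeff_ne_zero {τ : ℝ} {l j : ℕ} (h : modeCoeff τ l j ≠ 0) :
    ∃ i, l = j + 2 * i := by
  unfold modeCoeff at h
  split_ifs at h with hj
  · rcases Nat.even_or_odd' (l - j) with ⟨i, hi | hi⟩
    · exact ⟨i, by omega⟩
    · rw [hi, descent_odd] at h
      exact absurd rfl h
  · exact absurd rfl h

lemma modeCoeff_succ_self (τ : ℝ) (j : ℕ) : modeCoeff τ (j + 1) j = 0 := by
  by_contra h
  obtain ⟨i, hi⟩ := exists_of_modeCoeff_ne_zero h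
  omega

/-- Eliminating Im f_j and g_{j+1} from the system gives (Re f_j)'' = -(j+τ)² Re f_j - 2(j+1)(j+2)
Re f_{j+2}; this is that equation for oscillations at frequency l+τ. The cases l ≤ j+1 hold because
both sides vanish, so no range condition on j is needed. -/
lemma modeCoeff_rec {τ : ℝ} {l : ℕ} (h : NonResonant τ l) (j : ℕ) :
    ((l + τ) ^ 2 - (j + τ) ^ 2) * modeCoeff τ l j =
      2 * (j + 1) * (j + 2) * modeCoeff τ l (j + 2) := by
  rcases lt_trichotomy l j with hj | rfl | hj
  · rw [modeCoeff_of_lt hj, modeCoeff_of_lt (by omega)]; ring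
  · rw [modeCoeff_of_lt (j := l + 2) (by omega)]; ring
  · obtain ⟨i, rfl | ⟨i, rfl⟩⟩ : ∃ i, l = j + 1 ∨ ∃ i, l = j + 2 + i := by
      rcases Nat.lt_or_ge (j + 1) l with h1 | h1
      · exact ⟨0, Or.inr ⟨l - (j + 2), by omega⟩⟩
      · exact ⟨0, Or.inl (by omega)⟩
    · rw [modeCoeff_succ_self, modeCoeff_of_lt (by omega)]; ring
    · have hD := h.sq_ne j (by omega)
      have h1 : modeCoeff τ (j + 2 + i) j = 2 * ((j : ℝ) + 1) * (j + 2) /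
          ((((j + 2 + i : ℕ) : ℝ) + τ) ^ 2 - (j + τ) ^ 2) * modeCoeff τ (j + 2 + i) (j + 2) := by
        rw [modeCoeff, modeCoeff, if_pos (by omega), if_pos (by omega),
          show j + 2 + i - j = i + 2 by omega, show j + 2 + i - (j + 2) = i by omega, descent,
          show j + 2 + i - (i + 2) = j by omega]
      rw [h1]
      field_simp

/-- The exponential `α e^{i(l+τ)t}` driving a mode. -/
def wave (τ : ℝ) (l : ℕ) (α : ℂ) (t : ℝ) : ℂ :=
  α * Complex.exp (Complex.I * ((((l : ℝ) + τ : ℝ) : ℂ) * t))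

/-- The complex component of a mode at level `j`. -/
def modeF (τ : ℝ) (l : ℕ) (α : ℂ) (j : ℕ) (t : ℝ) : ℂ :=
  modeCoeff τ l j * ((wave τ l α t).re + Complex.I * ((((j + τ) / (l + τ) * (wave τ l α t).im : ℝ)) : ℂ))

/-- The real component of a mode at level `j`. -/
def modeG (τ : ℝ) (l : ℕ) (α : ℂ) (j : ℕ) (t : ℝ) : ℝ :=
  -((j + 1) / (l + τ)) * modeCoeff τ l (j + 1) * (wave τ l α t).im

lemma hasDerivAt_wave (τ : ℝ) (l : ℕ) (α : ℂ) (t : ℝ) :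
    HasDerivAt (wave τ l α) (Complex.I * ((l + τ : ℝ) : ℂ) * wave τ l α t) t := by
  have h1 : HasDerivAt (fun t : ℝ => Complex.I * ((((l : ℝ) + τ : ℝ) : ℂ) * (t : ℂ)))
      (Complex.I * (((l : ℝ) + τ : ℝ) : ℂ)) t := by
    simpa using! ((Complex.ofRealCLM.hasDerivAt (x := t)).const_mul
      (((l : ℝ) + τ : ℝ) : ℂ)).const_mul Complex.I
  have h2 := (h1.cexp).const_mul α
  refine h2.congr_deriv ?_
  simp only [wave]; ring

lemma hasDerivAt_wave_re (τ : ℝ) (l : ℕ) (α : ℂ) (t : ℝ) :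
    HasDerivAt (fun t => (wave τ l α t).re) (-((l + τ) * (wave τ l α t).im)) t := by
  refine ((Complex.reCLM.hasFDerivAt.comp_hasDerivAt t (hasDerivAt_wave τ l α t))).congr_deriv ?_
  rw [Complex.reCLM_apply, mul_assoc, Complex.I_mul_re, Complex.im_ofReal_mul]

lemma hasDerivAt_wave_im (τ : ℝ) (l : ℕ) (α : ℂ) (t : ℝ) :
    HasDerivAt (fun t => (wave τ l α t).im) ((l + τ) * (wave τ l α t).re) t := by
  refine ((Complex.imCLM.hasFDerivAt.comp_hasDerivAt t (hasDerivAt_wave τ l α t))).congr_deriv ?_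
  rw [Complex.imCLM_apply, mul_assoc, Complex.I_mul_im, Complex.re_ofReal_mul]

/-- The imaginary part holds by the choice of the factor (j+τ)/(l+τ); the real part is the recursion
`modeCoeff_rec` divided by the frequency. -/
lemma hasDerivAt_modeF {τ : ℝ} {l : ℕ} (h : NonResonant τ l) (α : ℂ) (j : ℕ) (t : ℝ) :
    HasDerivAt (modeF τ l α j) (Complex.I * ((j + τ : ℝ) : ℂ) * modeF τ l α j t +
      2 * (j + 1) * (modeG τ l α (j + 1) t : ℂ)) t := by
  have h1 := (hasDerivAt_wave_re τ l α t).ofReal_comp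
  have h2 := ((hasDerivAt_wave_im τ l α t).const_mul ((j + τ) / (l + τ))).ofReal_comp
  have h3 := (h1.add (h2.const_mul Complex.I)).const_mul (modeCoeff τ l j : ℂ)
  refine h3.congr_deriv ?_
  have hn := h.freq_ne
  have hr := modeCoeff_rec h j
  have hr' : modeCoeff τ l j * (l + τ) = ((j + τ) ^ 2 * modeCoeff τ l j +
      2 * (j + 1) * (j + 2) * modeCoeff τ l (j + 2)) / (l + τ) := by
    rw [eq_div_iff hn]; linear_combination hr
  have hc : ((l : ℂ) + τ) ≠ 0 := by exact_mod_cast hn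
  have hr'' : (modeCoeff τ l j : ℂ) * (l + τ) = (((j : ℂ) + τ) ^ 2 * modeCoeff τ l j +
      2 * (j + 1) * (j + 2) * modeCoeff τ l (j + 2)) / (l + τ) := by exact_mod_cast hr'
  simp only [modeF, modeG]
  push_cast
  rw [show (j : ℂ) + 1 + 1 = j + 2 by ring, show j + 1 + 1 = j + 2 by ring]
  have hI := Complex.I_mul_I
  field_simp at hr'' ⊢
  linear_combination (-(wave τ l α t).im : ℂ) * hr'' -
    (modeCoeff τ l j : ℂ) * (j + τ) ^ 2 * (wave τ l α t).im * hI

lemma hasDerivAt_modeG {τ : ℝ} {l : ℕ} (h : NonResonant τ l) (α : ℂ) (j : ℕ) (t : ℝ) :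
    HasDerivAt (modeG τ l α j) (-(j + 1) * (modeF τ l α (j + 1) t).re) t := by
  have hn := h.freq_ne
  refine ((hasDerivAt_wave_im τ l α t).const_mul _).congr_deriv ?_
  simp only [modeF, Complex.re_ofReal_mul, Complex.add_re, Complex.ofReal_re, Complex.I_mul_re,
    Complex.ofReal_im]
  field_simp
  ring

lemma modeF_im {τ : ℝ} {l : ℕ} (α : ℂ) (j : ℕ) (t : ℝ) :
    (modeF τ l α j t).im = modeCoeff τ l j * ((j + τ) / (l + τ) * (wave τ l α t).im) := by
  simp only [modeF, Complex.im_ofReal_mul, Complex.add_im, Complex.ofReal_im, Complex.I_mul_im,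
    Complex.ofReal_re, zero_add]

lemma modeF_re {τ : ℝ} {l : ℕ} (α : ℂ) (j : ℕ) (t : ℝ) :
    (modeF τ l α j t).re = modeCoeff τ l j * (wave τ l α t).re := by
  simp only [modeF, Complex.re_ofReal_mul, Complex.add_re, Complex.ofReal_im, Complex.I_mul_re,
    Complex.ofReal_re, neg_zero, add_zero]

/-- Exhibits the two frequencies ±(l+τ) of a mode, from which its Fourier coefficients are read off.
At the leading level j = l only the positive one survives. -/
lemma modeF_eq_exp (τ : ℝ) (l : ℕ) (α : ℂ) (j : ℕ) (t : ℝ) :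
    modeF τ l α j t = (modeCoeff τ l j * (1 + (j + τ) / (l + τ)) / 2 : ℂ) * wave τ l α t +
      (modeCoeff τ l j * (1 - (j + τ) / (l + τ)) / 2 : ℂ) * conj (wave τ l α t) := by
  conv_rhs => rw [← Complex.re_add_im (wave τ l α t)]
  simp only [map_add, map_mul, Complex.conj_ofReal, Complex.conj_I, modeF]
  push_cast
  ring

lemma wave_add_pi (m : ℤ) (l : ℕ) (α : ℂ) (t : ℝ) :
    wave m l α (t + Real.pi) = (-1) ^ ((l : ℤ) + m) * wave m l α t := by
  have : Complex.exp (Complex.I * (((l + m : ℤ) : ℂ) * Real.pi)) = (-1) ^ ((l : ℤ) + m) := by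
    rw [show Complex.I * (((l + m : ℤ) : ℂ) * Real.pi) = ((l + m : ℤ) : ℂ) * (Real.pi * Complex.I) by
      ring, Complex.exp_int_mul, Complex.exp_pi_mul_I]
  rw [wave, wave, ← this, mul_left_comm (Complex.exp _), ← Complex.exp_add]
  congr 2
  push_cast
  ring

/-! ### The explicit curves and their evolution equations -/

lemma hasDerivAt_C3 {f : ℝ → C3} {f' : C3} {t : ℝ}
    (h : ∀ i, HasDerivAt (fun t => f t i) (f' i) t) : HasDerivAt f f' t := by
  have h1 : HasDerivAt (fun t => WithLp.ofLp (f t)) (WithLp.ofLp f') t := hasDerivAt_pi.2 h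
  exact (PiLp.hasFDerivAt_toLp (𝕜 := ℝ) 2 (WithLp.ofLp (f t))).comp_hasDerivAt t h1

lemma hasDerivAt_apply_C3 {f : ℝ → C3} {f' : C3} {t : ℝ} (h : HasDerivAt f f' t) (i : Fin 3) :
    HasDerivAt (fun t => f t i) (f' i) t :=
  (PiLp.hasFDerivAt_apply (𝕜 := ℝ) 2 (f t) i).comp_hasDerivAt t h

/-- The amplitude of the mode of `h` with leading level `l`. -/
def Params.beta {k : ℕ} (c : Params k) (l : ℕ) : ℂ :=
  Complex.I * (2 * conj (c.B l) - ((l + 2 : ℝ) / l : ℝ) * c.A (l + 2))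

section Components
variable {k : ℕ} (c : Params k) (j : ℕ) (t : ℝ)

/-- The component of the solution driven by the `A_l`. -/
def solS : ℂ := ∑ l ∈ Finset.Icc 3 k, modeF (-1) l (2 * c.A l) j t

/-- The imaginary part of the third coordinate of the solution. -/
def solEta : ℝ := ∑ l ∈ Finset.Icc 3 k, modeG (-1) l (2 * c.A l) j t

/-- The component of the solution driven by the amplitudes `β_l`. -/
def solH : ℂ := ∑ l ∈ Finset.Icc 1 k, modeF 1 l (c.beta l) j t

/-- The real part of the third coordinate of the solution. -/
def solRho : ℝ := ∑ l ∈ Finset.Icc 1 k, modeG 1 l (c.beta l) j t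

/-- The explicit solution of the evolution equations with parameters `c`. -/
def sol : C3 :=
  !₂[Complex.exp (Complex.I * t) * ((solS c j t + Complex.I * conj (solH c j t)) / 2),
     Complex.exp (-(Complex.I * t)) * ((solH c j t - Complex.I * conj (solS c j t)) / 2),
     solRho c j t + Complex.I * solEta c j t]

end Components

section
variable {k : ℕ} (c : Params k) (j : ℕ) (t : ℝ)

lemma hasDerivAt_solS : HasDerivAt (solS c j) (Complex.I * (j - 1) * solS c j t +
    2 * (j + 1) * (solEta c (j + 1) t : ℂ)) t := by
  have h := HasDerivAt.fun_sum (u := Finset.Icc 3 k) fun l hl =>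
    hasDerivAt_modeF (nonResonant_neg_one (Finset.mem_Icc.1 hl).1) (2 * c.A l) j t
  refine h.congr_deriv ?_
  rw [solS, solEta, Finset.sum_add_distrib, ← Finset.mul_sum, ← Finset.mul_sum]
  push_cast
  ring

lemma hasDerivAt_solH : HasDerivAt (solH c j) (Complex.I * (j + 1) * solH c j t +
    2 * (j + 1) * (solRho c (j + 1) t : ℂ)) t := by
  have h := HasDerivAt.fun_sum (u := Finset.Icc 1 k) fun l _ =>
    hasDerivAt_modeF (nonResonant_one l) (c.beta l) j t
  refine h.congr_deriv ?_
  rw [solH, solRho, Finset.sum_add_distrib, ← Finset.mul_sum, ← Finset.mul_sum]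
  push_cast
  ring

lemma hasDerivAt_solEta : HasDerivAt (solEta c j) (-(j + 1) * (solS c (j + 1) t).re) t := by
  have h := HasDerivAt.fun_sum (u := Finset.Icc 3 k) fun l hl =>
    hasDerivAt_modeG (nonResonant_neg_one (Finset.mem_Icc.1 hl).1) (2 * c.A l) j t
  refine h.congr_deriv ?_
  rw [solS, Complex.re_sum, ← Finset.mul_sum]

lemma hasDerivAt_solRho : HasDerivAt (solRho c j) (-(j + 1) * (solH c (j + 1) t).re) t := by
  have h := HasDerivAt.fun_sum (u := Finset.Icc 1 k) fun l _ =>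
    hasDerivAt_modeG (nonResonant_one l) (c.beta l) j t
  refine h.congr_deriv ?_
  rw [solH, Complex.re_sum, ← Finset.mul_sum]

/-- The condition on the Kähler form, in terms of the components. -/
lemma mul_solS_im (hj : 1 ≤ j) :
    j * (solS c j t).im = -((j - 1) * solEta c (j - 1) t) := by
  rw [solS, solEta, Complex.im_sum, Finset.mul_sum, Finset.mul_sum, ← Finset.sum_neg_distrib]
  refine Finset.sum_congr rfl fun l _ => ?_
  -- Mode by mode both sides equal j(j-1) m_j Im(wave)/(l-1), where m_j is the mode coefficient;
  -- this cancellation is particular to τ = -1.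
  obtain ⟨i, rfl⟩ : ∃ i, j = i + 1 := ⟨j - 1, by omega⟩
  rw [modeF_im, modeG, Nat.add_sub_cancel]
  push_cast
  ring

lemma modeF_eq_zero {τ : ℝ} {l j : ℕ} (h : l < j) (α : ℂ) (t : ℝ) : modeF τ l α j t = 0 := by
  simp [modeF, modeCoeff_of_lt h]

lemma modeG_eq_zero {τ : ℝ} {l j : ℕ} (h : l < j + 1) (α : ℂ) (t : ℝ) : modeG τ l α j t = 0 := by
  simp [modeG, modeCoeff_of_lt h]

lemma solS_eq_zero (h : k < j) : solS c j t = 0 :=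
  Finset.sum_eq_zero fun _ hl => modeF_eq_zero ((Finset.mem_Icc.1 hl).2.trans_lt h) _ _

lemma solH_eq_zero (h : k < j) : solH c j t = 0 :=
  Finset.sum_eq_zero fun _ hl => modeF_eq_zero ((Finset.mem_Icc.1 hl).2.trans_lt h) _ _

lemma solEta_eq_zero (h : k ≤ j) : solEta c j t = 0 :=
  Finset.sum_eq_zero fun _ hl =>
    modeG_eq_zero (((Finset.mem_Icc.1 hl).2.trans h).trans_lt (Nat.lt_succ_self j)) _ _

lemma solRho_eq_zero (h : k ≤ j) : solRho c j t = 0 :=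
  Finset.sum_eq_zero fun _ hl =>
    modeG_eq_zero (((Finset.mem_Icc.1 hl).2.trans h).trans_lt (Nat.lt_succ_self j)) _ _

lemma conj_exp_I_mul : conj (Complex.exp (Complex.I * t)) = Complex.exp (-(Complex.I * t)) := by
  rw [← Complex.exp_conj]; simp

lemma conj_exp_neg_I_mul :
    conj (Complex.exp (-(Complex.I * t))) = Complex.exp (Complex.I * t) := by
  rw [← Complex.exp_conj]; simp

lemma exp_mul_exp_neg : Complex.exp (Complex.I * t) * Complex.exp (-(Complex.I * t)) = 1 := by
  rw [← Complex.exp_add]; simp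

lemma hasDerivAt_exp_I_mul : HasDerivAt (fun t : ℝ => Complex.exp (Complex.I * t))
    (Complex.I * Complex.exp (Complex.I * t)) t := by
  have h1 : HasDerivAt (fun t : ℝ => Complex.I * (t : ℂ)) Complex.I t := by
    simpa using! (Complex.ofRealCLM.hasDerivAt (x := t)).const_mul Complex.I
  exact h1.cexp.congr_deriv (mul_comm _ _)

lemma hasDerivAt_exp_neg_I_mul : HasDerivAt (fun t : ℝ => Complex.exp (-(Complex.I * t)))
    (-Complex.I * Complex.exp (-(Complex.I * t))) t := by
  have h1 : HasDerivAt (fun t : ℝ => -(Complex.I * (t : ℂ))) (-Complex.I) t := by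
    simpa using! ((Complex.ofRealCLM.hasDerivAt (x := t)).const_mul Complex.I).neg
  exact h1.cexp.congr_deriv (mul_comm _ _)

lemma hasDerivAt_conj {f : ℝ → ℂ} {f' : ℂ} {t : ℝ} (h : HasDerivAt f f' t) :
    HasDerivAt (fun t => conj (f t)) (conj f') t :=
  Complex.conjCLE.toContinuousLinearMap.hasFDerivAt.comp_hasDerivAt t h

/-- The evolution equations, uniformly in the level. -/
lemma hasDerivAt_sol : HasDerivAt (sol c j)
    ((2 * (j + 1) : ℝ) • cross (sol c (j + 1) t) (q1 t) + (2 * j : ℝ) • cross (sol c j t) (q2 t))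
    t := by
  have hS := hasDerivAt_solS c j t
  have hH := hasDerivAt_solH c j t
  have hI := Complex.I_mul_I
  have hw := exp_mul_exp_neg t
  have h2 : conj (2 : ℂ) = 2 := Complex.conj_ofNat 2
  refine hasDerivAt_C3 fun i => ?_
  fin_cases i
  · refine ((hasDerivAt_exp_I_mul t).mul
      ((hS.add ((hasDerivAt_conj hH).const_mul Complex.I)).div_const 2)).congr_deriv ?_
    simp [cross, sol, q1, q2, conj_exp_I_mul, conj_exp_neg_I_mul, h2]
    linear_combination (Complex.exp (Complex.I * t) / 2) * (-(j : ℂ) * conj (solH c j t)) * hI +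
      (j + 1) * Complex.exp (Complex.I * t) * (solEta c (j + 1) t) * hI
  · refine ((hasDerivAt_exp_neg_I_mul t).mul
      ((hH.sub ((hasDerivAt_conj hS).const_mul Complex.I)).div_const 2)).congr_deriv ?_
    simp [cross, sol, q1, q2, conj_exp_I_mul, conj_exp_neg_I_mul, h2]
    linear_combination (Complex.exp (-(Complex.I * t)) / 2) * (j : ℂ) * conj (solS c j t) * hI
  · refine ((hasDerivAt_solRho c j t).ofReal_comp.add
      ((hasDerivAt_solEta c j t).ofReal_comp.const_mul Complex.I)).congr_deriv ?_
    simp [cross, sol, q1, q2, conj_exp_I_mul, conj_exp_neg_I_mul, h2]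
    have h1 : ((solS c (j + 1) t).re : ℂ) =
      (solS c (j + 1) t + conj (solS c (j + 1) t)) / 2 := by
      rw [Complex.add_conj]; push_cast; ring
    have h3 : ((solH c (j + 1) t).re : ℂ) =
      (solH c (j + 1) t + conj (solH c (j + 1) t)) / 2 := by
      rw [Complex.add_conj]; push_cast; ring
    rw [h1, h3]
    linear_combination ((j : ℂ) + 1) / 2 * ((conj (solH c (j + 1) t) +
      Complex.I * solS c (j + 1) t + Complex.I * conj (solS c (j + 1) t) -
      Complex.I ^ 2 * solH c (j + 1) t) * hw - solH c (j + 1) t * hI)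
end

/-! ### Fourier coefficients and the constants of integration -/

section Coeff

lemma coeff_add {f g : ℝ → ℂ} (hf : Continuous f) (hg : Continuous g) (n : ℤ) :
    coeff (fun t => f t + g t) n = coeff f n + coeff g n := by
  unfold coeff
  rw [← mul_add, ← intervalIntegral.integral_add]
  · simp only [mul_add]
  · exact (Continuous.mul (by fun_prop) hf).intervalIntegrable _ _
  · exact (Continuous.mul (by fun_prop) hg).intervalIntegrable _ _

lemma coeff_const_mul (f : ℝ → ℂ) (a : ℂ) (n : ℤ) :
    coeff (fun t => a * f t) n = a * coeff f n := by
  unfold coeff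
  simp only [mul_left_comm _ a]
  rw [intervalIntegral.integral_const_mul]
  ring

lemma coeff_sub {f g : ℝ → ℂ} (hf : Continuous f) (hg : Continuous g) (n : ℤ) :
    coeff (fun t => f t - g t) n = coeff f n - coeff g n := by
  have := coeff_add hf (hg.const_mul (-1)) n
  rw [coeff_const_mul] at this
  simpa [sub_eq_add_neg] using this

lemma coeff_sum {ι : Type*} (s : Finset ι) {f : ι → ℝ → ℂ} (hf : ∀ i, Continuous (f i)) (n : ℤ) :
    coeff (fun t => ∑ i ∈ s, f i t) n = ∑ i ∈ s, coeff (f i) n := by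
  classical
  induction s using Finset.induction_on with
  | empty => simp [coeff]
  | insert i s hi ih =>
    simp only [Finset.sum_insert hi]
    rw [coeff_add (hf i) (continuous_finsetSum _ fun j _ => hf j), ih]

lemma coeff_exp (m n : ℤ) :
    coeff (fun t => Complex.exp (Complex.I * m * t)) n = if m = n then 1 else 0 := by
  unfold coeff
  have h1 : ∀ t : ℝ, Complex.exp (-(Complex.I * n * t)) * Complex.exp (Complex.I * m * t) =
      Complex.exp ((Complex.I * (m - n : ℤ)) * t) := fun t => by
    rw [← Complex.exp_add]; push_cast; ring_nf
  simp only [h1]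
  have hpi : (Real.pi : ℂ) ≠ 0 := by exact_mod_cast Real.pi_ne_zero
  split_ifs with h
  · subst h
    simp
    field_simp
    norm_num
  · have hc : Complex.I * (m - n : ℤ) ≠ 0 :=
      mul_ne_zero Complex.I_ne_zero (by exact_mod_cast sub_ne_zero.2 h)
    rw [integral_exp_mul_complex hc]
    -- The primitive takes the same value at π and -π because the frequency is an integer.
    have h2 : Complex.exp (Complex.I * (m - n : ℤ) * (Real.pi : ℝ)) =
        Complex.exp (Complex.I * (m - n : ℤ) * ((-Real.pi : ℝ) : ℂ)) := by
      rw [Complex.exp_eq_exp_iff_exists_int]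
      exact ⟨m - n, by push_cast; ring⟩
    rw [h2]; simp

lemma coeff_const (a : ℂ) : coeff (fun _ => a) 0 = a := by
  have := coeff_const_mul (fun t => Complex.exp (Complex.I * (0 : ℤ) * t)) a 0
  rw [coeff_exp] at this
  simpa using this

end Coeff

lemma continuous_modeF (τ : ℝ) (l : ℕ) (α : ℂ) (j : ℕ) : Continuous (modeF τ l α j) := by
  unfold modeF wave; fun_prop

lemma continuous_modeG (τ : ℝ) (l : ℕ) (α : ℂ) (j : ℕ) : Continuous (modeG τ l α j) := by
  unfold modeG wave; fun_prop

/-- The factor e^{irt} accounts for the prefactors e^{±it} in the first two coordinates of `sol`. -/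
lemma coeff_exp_mul_modeF (τ r : ℤ) (l : ℕ) (α : ℂ) (j : ℕ) (n : ℤ) :
    coeff (fun t => Complex.exp (Complex.I * r * t) * modeF τ l α j t) n =
      (modeCoeff τ l j * (1 + (j + τ) / (l + τ)) / 2 : ℂ) * α *
        (if r + (l + τ) = n then 1 else 0) +
      (modeCoeff τ l j * (1 - (j + τ) / (l + τ)) / 2 : ℂ) * conj α *
        (if r - (l + τ) = n then 1 else 0) := by
  rw [← coeff_exp, ← coeff_exp, ← coeff_const_mul, ← coeff_const_mul,
    ← coeff_add (by fun_prop) (by fun_prop)]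
  congr 1
  funext t
  rw [modeF_eq_exp, wave, map_mul, ← Complex.exp_conj]
  simp only [map_mul, Complex.conj_ofReal, Complex.conj_I]
  push_cast
  rw [show Complex.I * ((r : ℂ) + (l + τ)) * t = Complex.I * r * t + Complex.I * ((l + τ) * t) by
      ring, show Complex.I * ((r : ℂ) - (l + τ)) * t = Complex.I * r * t +
      -Complex.I * ((l + τ) * t) by ring, Complex.exp_add, Complex.exp_add]
  ring

lemma coeff_exp_mul_conj_modeF (τ r : ℤ) (l : ℕ) (α : ℂ) (j : ℕ) (n : ℤ) :
    coeff (fun t => Complex.exp (Complex.I * r * t) * conj (modeF τ l α j t)) n =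
      (modeCoeff τ l j * (1 + (j + τ) / (l + τ)) / 2 : ℂ) * conj α *
        (if r - (l + τ) = n then 1 else 0) +
      (modeCoeff τ l j * (1 - (j + τ) / (l + τ)) / 2 : ℂ) * α *
        (if r + (l + τ) = n then 1 else 0) := by
  rw [← coeff_exp, ← coeff_exp, ← coeff_const_mul, ← coeff_const_mul,
    ← coeff_add (by fun_prop) (by fun_prop)]
  congr 1
  funext t
  rw [modeF_eq_exp, wave, map_mul, ← Complex.exp_conj]
  simp only [map_mul, map_add, map_sub, map_div₀, map_one, Complex.conj_ofReal, Complex.conj_I,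
    Complex.conj_conj, map_ofNat, map_natCast, ← Complex.exp_conj, map_neg]
  push_cast
  rw [show Complex.I * ((r : ℂ) + (l + τ)) * t = Complex.I * r * t + Complex.I * ((l + τ) * t) by
      ring, show Complex.I * ((r : ℂ) - (l + τ)) * t = Complex.I * r * t +
      -Complex.I * ((l + τ) * t) by ring, Complex.exp_add, Complex.exp_add, neg_neg]
  ring

lemma coeff_modeG (τ : ℤ) {l : ℕ} (h : (l : ℤ) + τ ≠ 0) (α : ℂ) (j : ℕ) :
    coeff (fun t => (modeG τ l α j t : ℂ)) 0 = 0 := by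
  have h1 : ∀ t, (modeG τ l α j t : ℂ) =
      (-((j + 1) / (l + τ)) * modeCoeff τ l (j + 1) * α / (2 * Complex.I)) *
        Complex.exp (Complex.I * (l + τ : ℤ) * t) +
      (((j + 1) / (l + τ)) * modeCoeff τ l (j + 1) * conj α / (2 * Complex.I)) *
        Complex.exp (Complex.I * (-(l + τ) : ℤ) * t) := fun t => by
    rw [modeG]
    push_cast
    rw [Complex.im_eq_sub_conj, wave, map_mul, ← Complex.exp_conj]
    simp only [map_mul, Complex.conj_ofReal, Complex.conj_I]
    push_cast
    rw [show Complex.I * (-(↑l + ↑τ) : ℂ) * t = -Complex.I * ((l + τ) * t) by ring,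
      show Complex.I * ((↑l + ↑τ) : ℂ) * t = Complex.I * ((l + τ) * t) by ring]
    ring
  simp only [h1]
  rw [coeff_add (by fun_prop) (by fun_prop), coeff_const_mul, coeff_const_mul, coeff_exp,
    coeff_exp, if_neg h, if_neg (by omega)]
  simp

section Coefficients
variable {k : ℕ} (c : Params k) (j : ℕ) (n : ℤ)

lemma coeff_sol_zero :
    coeff (fun t => sol c j t 0) n =
      (1 / 2) * (∑ l ∈ Finset.Icc 3 k,
        coeff (fun t => Complex.exp (Complex.I * (1 : ℤ) * t) *
          modeF (-1 : ℤ) l (2 * c.A l) j t) n) +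
      (Complex.I / 2) * (∑ l ∈ Finset.Icc 1 k,
        coeff (fun t => Complex.exp (Complex.I * (1 : ℤ) * t) *
          conj (modeF (1 : ℤ) l (c.beta l) j t)) n) := by
  have hF := continuous_modeF
  have hF' : ∀ (τ : ℝ) l α j, Continuous fun t => conj (modeF τ l α j t) :=
    fun τ l α j => Complex.continuous_conj.comp (hF τ l α j)
  rw [← coeff_sum, ← coeff_sum, ← coeff_const_mul, ← coeff_const_mul, ← coeff_add]
  · congr 1
    funext t
    simp only [sol, solS, solH, map_sum]
    simp only [← Finset.mul_sum]
    simp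
    ring
  all_goals fun_prop

lemma coeff_sol_one :
    coeff (fun t => sol c j t 1) n =
      (1 / 2) * (∑ l ∈ Finset.Icc 1 k,
        coeff (fun t => Complex.exp (Complex.I * (-1 : ℤ) * t) *
          modeF (1 : ℤ) l (c.beta l) j t) n) +
      (-Complex.I / 2) * (∑ l ∈ Finset.Icc 3 k,
        coeff (fun t => Complex.exp (Complex.I * (-1 : ℤ) * t) *
          conj (modeF (-1 : ℤ) l (2 * c.A l) j t)) n) := by
  have hF := continuous_modeF
  have hF' : ∀ (τ : ℝ) l α j, Continuous fun t => conj (modeF τ l α j t) :=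
    fun τ l α j => Complex.continuous_conj.comp (hF τ l α j)
  rw [← coeff_sum, ← coeff_sum, ← coeff_const_mul, ← coeff_const_mul, ← coeff_add]
  · congr 1
    funext t
    simp only [sol, solS, solH, map_sum]
    simp only [← Finset.mul_sum]
    simp
    ring
  all_goals fun_prop

lemma coeff_sol_two : coeff (fun t => sol c j t 2) 0 = 0 := by
  have hG : ∀ (τ : ℝ) l α j, Continuous fun t => (modeG τ l α j t : ℂ) :=
    fun τ l α j => Complex.continuous_ofReal.comp (continuous_modeG τ l α j)
  have h1 : coeff (fun t => sol c j t 2) 0 = (∑ l ∈ Finset.Icc 1 k,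
      coeff (fun t => (modeG (1 : ℤ) l (c.beta l) j t : ℂ)) 0) + Complex.I *
      (∑ l ∈ Finset.Icc 3 k, coeff (fun t => (modeG (-1 : ℤ) l (2 * c.A l) j t : ℂ)) 0) := by
    rw [← coeff_sum, ← coeff_sum, ← coeff_const_mul, ← coeff_add]
    · congr 1
      funext t
      simp [sol, solEta, solRho]
    all_goals fun_prop
  rw [h1, Finset.sum_eq_zero fun l _ => coeff_modeG _ (by omega) _ _,
    Finset.sum_eq_zero fun l hl => coeff_modeG _ ?_ _ _]
  · simp
  · have := (Finset.mem_Icc.1 hl).1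
    omega

lemma Params.A_of_lt {l : ℕ} (h : k < l) : c.A l = 0 := by
  simp [Params.A, Nat.not_le.2 h]

lemma Params.A_of_lt_three {l : ℕ} (h : l < 3) : c.A l = 0 := by
  simp [Params.A, Nat.not_le.2 h]

/-- The one driven coefficient that enters the coefficient of e^{-ijt} in a_j, and so the reason for
the term (l+2)/l · A_{l+2} in `Params.beta`. -/
lemma modeCoeff_neg_one_two_below (hj : 1 ≤ j) :
    modeCoeff (-1) (j + 2) j = (j + 1) * (j + 2) / (2 * j) := by
  have h := modeCoeff_rec (nonResonant_neg_one (l := j + 2) (by omega)) j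
  rw [modeCoeff_self] at h
  have hj' : (0 : ℝ) < j := by exact_mod_cast hj
  rw [eq_div_iff (by positivity)]
  push_cast at h
  linear_combination h / 2

/-- An s-mode contributes the frequencies l and 2-l to a_j, and an h-mode contributes -l and l+2.
Frequency j therefore leaves l = j among the s-modes, and l = j-2 among the h-modes, which does not
reach level j. -/
lemma coeff_sol_A (hj : 1 ≤ j) : coeff (fun t => sol c j t 0) j = c.A j := by
  rw [coeff_sol_zero]
  simp only [coeff_exp_mul_modeF, coeff_exp_mul_conj_modeF]
  have h1 : ∀ l ∈ Finset.Icc 1 k,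
      (modeCoeff ((1 : ℤ) : ℝ) l j * (1 + (j + (1 : ℤ)) / (l + (1 : ℤ))) / 2 : ℂ) *
        conj (c.beta l) * (if (1 : ℤ) - (l + (1 : ℤ)) = j then 1 else 0) +
      (modeCoeff ((1 : ℤ) : ℝ) l j * (1 - (j + (1 : ℤ)) / (l + (1 : ℤ))) / 2 : ℂ) * c.beta l *
        (if (1 : ℤ) + (l + (1 : ℤ)) = j then 1 else 0) = 0 := by
    intro l hl
    rw [if_neg (by omega)]
    split_ifs with h
    · rw [modeCoeff_of_lt (by omega)]; simp
    · simp
  rw [Finset.sum_eq_zero h1]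
  rcases Nat.lt_or_ge j 3 with h3 | h3
  · rw [c.A_of_lt_three h3, Finset.sum_eq_zero]
    · simp
    · intro l hl
      rw [Finset.mem_Icc] at hl
      rw [if_neg (by omega), if_neg (by omega)]; simp
  rcases Nat.lt_or_ge k j with hk | hk
  · rw [c.A_of_lt hk, Finset.sum_eq_zero]
    · simp
    · intro l hl
      rw [Finset.mem_Icc] at hl
      rw [if_neg (by omega), if_neg (by omega)]; simp
  · rw [Finset.sum_eq_single_of_mem j (Finset.mem_Icc.2 ⟨h3, hk⟩)]
    · rw [if_pos (by omega), if_neg (by omega), modeCoeff_self]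
      have : ((j : ℂ) + ((-1 : ℤ) : ℂ)) ≠ 0 := by
        have : (j : ℤ) + (-1) ≠ 0 := by omega
        exact_mod_cast this
      rw [div_self this]
      simp
    · intro l hl hlj
      rw [Finset.mem_Icc] at hl
      rw [if_neg (by omega), if_neg (by omega)]; simp

/-- Frequency -j in a_j comes from the s-mode l = j+2 and the h-mode l = j, so B_j = (j+2)/(2j) ·
conj A_{j+2} + (i/2) conj β_j. The definition of β_j is this equation solved for β_j. -/
lemma coeff_sol_B (hj : 1 ≤ j) (hk : j ≤ k) : coeff (fun t => sol c j t 0) (-j) = c.B j := by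
  rw [coeff_sol_zero]
  simp only [coeff_exp_mul_modeF, coeff_exp_mul_conj_modeF]
  have hjc : (j : ℂ) ≠ 0 := by exact_mod_cast (by omega : j ≠ 0)
  have hj1 : (j : ℂ) + 1 ≠ 0 := by exact_mod_cast (by omega : j + 1 ≠ 0)
  have hS : (∑ l ∈ Finset.Icc 3 k,
      ((modeCoeff ((-1 : ℤ) : ℝ) l j * (1 + (j + (-1 : ℤ)) / (l + (-1 : ℤ))) / 2 : ℂ) *
        (2 * c.A l) * (if (1 : ℤ) + (l + (-1 : ℤ)) = -j then 1 else 0) +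
      (modeCoeff ((-1 : ℤ) : ℝ) l j * (1 - (j + (-1 : ℤ)) / (l + (-1 : ℤ))) / 2 : ℂ) *
        conj (2 * c.A l) * (if (1 : ℤ) - (l + (-1 : ℤ)) = -j then 1 else 0))) =
      (j + 2) / j * conj (c.A (j + 2)) := by
    rcases Nat.lt_or_ge k (j + 2) with hk2 | hk2
    · rw [c.A_of_lt hk2, Finset.sum_eq_zero]
      · simp
      · intro l hl
        rw [Finset.mem_Icc] at hl
        rw [if_neg (by omega), if_neg (by omega)]; simp
    · rw [Finset.sum_eq_single_of_mem (j + 2) (Finset.mem_Icc.2 ⟨by omega, hk2⟩)]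
      · rw [if_neg (by omega), if_pos (by push_cast; ring), Int.cast_neg, Int.cast_one,
          modeCoeff_neg_one_two_below j hj]
        push_cast
        rw [show (j : ℂ) + 2 + -1 = j + 1 by ring, map_mul, map_ofNat]
        field_simp
        ring
      · intro l hl hlj
        rw [Finset.mem_Icc] at hl
        rw [if_neg (by omega), if_neg (by omega)]; simp
  rw [hS, Finset.sum_eq_single_of_mem j (Finset.mem_Icc.2 ⟨hj, hk⟩)]
  · rw [if_pos (by omega), if_neg (by omega), Int.cast_one, modeCoeff_self, Params.beta]
    push_cast
    rw [div_self hj1]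
    simp only [map_mul, map_sub, map_add, map_div₀, Complex.conj_I, Complex.conj_conj,
      map_ofNat, map_natCast]
    field_simp
    linear_combination (-2 * (2 * j * c.B j - ((j : ℂ) + 2) * conj (c.A (j + 2)))) * Complex.I_sq
  · intro l hl hlj
    rw [if_neg (by omega), if_neg (by omega)]; simp

/-- A constant term in a_0 or b_0 could come only from an s-mode with l = 2, and these start at l =
3. -/
lemma coeff_sol_level_zero (i : Fin 3) : coeff (fun t => sol c 0 t i) 0 = 0 := by
  fin_cases i
  · change coeff (fun t => sol c 0 t 0) 0 = 0
    rw [coeff_sol_zero]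
    simp only [coeff_exp_mul_modeF, coeff_exp_mul_conj_modeF]
    rw [Finset.sum_eq_zero, Finset.sum_eq_zero]
    · simp
    all_goals
      intro l hl
      rw [Finset.mem_Icc] at hl
      rw [if_neg (by omega), if_neg (by omega)]; simp
  · change coeff (fun t => sol c 0 t 1) 0 = 0
    rw [coeff_sol_one]
    simp only [coeff_exp_mul_modeF, coeff_exp_mul_conj_modeF]
    rw [Finset.sum_eq_zero, Finset.sum_eq_zero]
    · simp
    all_goals
      intro l hl
      rw [Finset.mem_Icc] at hl
      rw [if_neg (by omega), if_neg (by omega)]; simp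
  · exact coeff_sol_two c 0

end Coefficients

/-! ### Existence -/

lemma isEvolution_sol {k : ℕ} (c : Params k) : IsEvolution k (sol c) q1 q2 where
  p_eq_zero j hj := by
    funext t
    ext i
    fin_cases i <;> simp [sol, solS_eq_zero c j t hj, solH_eq_zero c j t hj,
      solEta_eq_zero c j t hj.le, solRho_eq_zero c j t hj.le]
  deriv_p_zero t := by simpa using hasDerivAt_sol c 0 t
  deriv_p_mid j _ _ t := hasDerivAt_sol c j t
  deriv_p_top t := by
    refine (hasDerivAt_sol c k t).congr_deriv ?_
    have : sol c (k + 1) t = 0 := by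
      ext i
      fin_cases i <;> simp [sol, solS_eq_zero, solH_eq_zero, solEta_eq_zero, solRho_eq_zero]
    rw [this]
    have h0 : cross 0 (q1 t) = 0 := by ext i; fin_cases i <;> simp [cross]
    rw [h0, smul_zero, zero_add]
  deriv_q_one t := by
    refine hasDerivAt_C3 fun i => ?_
    fin_cases i
    · refine (hasDerivAt_exp_I_mul t).congr_deriv ?_
      simp [cross, q1, q2, conj_exp_neg_I_mul]
    · refine ((hasDerivAt_exp_neg_I_mul t).const_mul Complex.I).congr_deriv ?_
      simp [cross, q1, q2, conj_exp_I_mul]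
      linear_combination (-Complex.exp (-(Complex.I * t))) * Complex.I_mul_I
    · refine (hasDerivAt_const t (0 : ℂ)).congr_deriv ?_
      simp [cross, q1, q2]
  deriv_q_two t := hasDerivAt_const t _
  omega_q t := by simp [kahlerForm, q1, q2, Fin.sum_univ_three]
  omega_top t := by
    simp [kahlerForm, q2, sol, Fin.sum_univ_three, solEta_eq_zero]
  omega_mid j hj _ t := by
    have h := mul_solS_im c j t hj
    have h1 : kahlerForm (sol c j t) (q1 t) = -(solS c j t).im := by
      have hw := exp_mul_exp_neg t
      have : ∑ i, conj (sol c j t i) * q1 t i =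
          (conj (solS c j t) - Complex.I * solH c j t) / 2 +
          Complex.I * ((conj (solH c j t) + Complex.I * solS c j t) / 2) := by
        have h2 : conj (2 : ℂ) = 2 := Complex.conj_ofNat 2
        simp [q1, sol, Fin.sum_univ_three, conj_exp_I_mul, conj_exp_neg_I_mul, h2]
        linear_combination ((conj (solS c j t) - Complex.I * solH c j t) / 2 +
          Complex.I * ((conj (solH c j t) + Complex.I * solS c j t) / 2)) * hw
      rw [kahlerForm, this]
      simp
      ring
    have h2 : kahlerForm (sol c (j - 1) t) (q2 t) = -solEta c (j - 1) t := by
      simp [kahlerForm, q2, sol, Fin.sum_univ_three]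
    rw [h1, h2]
    linear_combination -h

lemma isMember_sol {k : ℕ} (c : Params k) : IsMember k c (sol c) :=
  ⟨isEvolution_sol c,
    { coeff_A := fun j hj _ => coeff_sol_A c j hj
      coeff_B := fun j hj hjk => coeff_sol_B c j hj hjk
      coeff_C := fun j _ _ => coeff_sol_two c j
      coeff_zero := coeff_sol_level_zero c }⟩

/-! ### Uniqueness -/

lemma cross_zero_left (s : C3) : cross 0 s = 0 := by
  ext i; fin_cases i <;> simp [cross]

lemma IsEvolution.hasDerivAt {k : ℕ} {p : ℕ → ℝ → C3} {r₁ r₂ : ℝ → C3} (hk : 1 ≤ k)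
    (h : IsEvolution k p r₁ r₂) {j : ℕ} (hj : j ≤ k) (t : ℝ) :
    HasDerivAt (p j) ((2 * (j + 1) : ℝ) • cross (p (j + 1) t) (r₁ t) +
      (2 * j : ℝ) • cross (p j t) (r₂ t)) t := by
  rcases Nat.eq_zero_or_pos j with rfl | hj0
  · simpa using h.deriv_p_zero t
  rcases hj.lt_or_eq with hjk | rfl
  · exact h.deriv_p_mid j hj0 hjk t
  · rw [h.p_eq_zero (j + 1) (Nat.lt_succ_self j)]
    simpa [cross_zero_left] using h.deriv_p_top t

/-- A solution of `f' = i m f` is a multiple of `e^{imt}`. -/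
lemma eq_exp_of_hasDerivAt {f : ℝ → ℂ} {m : ℤ}
    (h : ∀ t, HasDerivAt f (Complex.I * m * f t) t) (t : ℝ) :
    f t = f 0 * Complex.exp (Complex.I * m * t) := by
  have hE : ∀ t : ℝ, HasDerivAt (fun t : ℝ => Complex.exp (-(Complex.I * m) * (t : ℂ)))
      (-(Complex.I * m) * Complex.exp (-(Complex.I * m) * (t : ℂ))) t := fun t => by
    have h1 : HasDerivAt (fun t : ℝ => -(Complex.I * m) * (t : ℂ)) (-(Complex.I * m)) t := by
      simpa using! (Complex.ofRealCLM.hasDerivAt (x := t)).const_mul (-(Complex.I * m))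
    exact h1.cexp.congr_deriv (mul_comm _ _)
  have hd : ∀ t, HasDerivAt (fun t : ℝ => Complex.exp (-(Complex.I * m) * (t : ℂ)) * f t) 0 t :=
    fun t => ((hE t).mul (h t)).congr_deriv (by ring)
  have hc := is_const_of_deriv_eq_zero (fun t => (hd t).differentiableAt)
    (fun t => (hd t).deriv) t 0
  simp only [Complex.ofReal_zero, mul_zero, Complex.exp_zero, one_mul] at hc
  rw [← hc, mul_right_comm, ← Complex.exp_add]
  simp

lemma IsMember.continuous {k : ℕ} {c : Params k} {p : ℕ → ℝ → C3} (hk : 1 ≤ k)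
    (h : IsMember k c p) {j : ℕ} (hj : j ≤ k) (i : Fin 3) : Continuous fun t => p j t i :=
  continuous_iff_continuousAt.2 fun t => (hasDerivAt_apply_C3 (h.1.hasDerivAt hk hj t) i).continuousAt

/-- Once the curves agree at level j+1, their difference d at level j solves d' = 2j d × q_2. This
constant-coefficient system is diagonal in d_0 ∓ i conj d_1, with frequencies ±j, and has d_2
constant; the prescribed Fourier coefficients are exactly its free constants. -/
lemma IsMember.unique {k : ℕ} {c : Params k} {p p' : ℕ → ℝ → C3} (hk : 1 ≤ k)
    (h : IsMember k c p) (h' : IsMember k c p') : p = p' := by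
  -- Downward induction, with n = k+1-j, starting at level k+1 where both curves are zero by
  -- convention.
  suffices H : ∀ n j, j + n = k + 1 → p j = p' j by
    funext j
    rcases Nat.lt_or_ge k j with hj | hj
    · rw [h.1.p_eq_zero j hj, h'.1.p_eq_zero j hj]
    · exact H (k + 1 - j) j (by omega)
  intro n
  induction n with
  | zero =>
    intro j hj
    rw [h.1.p_eq_zero j (by omega), h'.1.p_eq_zero j (by omega)]
  | succ n ih =>
    intro j hj
    have hjk : j ≤ k := by omega
    have hnext := ih (j + 1) (by omega)
    have hI := Complex.I_mul_I
    have hd : ∀ t i, HasDerivAt (fun t => p j t i - p' j t i)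
        (((2 * j : ℝ) • cross (p j t) (q2 t)) i - ((2 * j : ℝ) • cross (p' j t) (q2 t)) i) t := by
      intro t i
      refine ((hasDerivAt_apply_C3 (h.1.hasDerivAt hk hjk t) i).sub
        (hasDerivAt_apply_C3 (h'.1.hasDerivAt hk hjk t) i)).congr_deriv ?_
      simp [hnext]
    have h0 : ∀ t, HasDerivAt (fun t => p j t 0 - p' j t 0)
        (j * conj (p j t 1 - p' j t 1)) t := fun t => by
      refine (hd t 0).congr_deriv ?_
      simp [cross, q2]; ring
    have h1 : ∀ t, HasDerivAt (fun t => p j t 1 - p' j t 1)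
        (-j * conj (p j t 0 - p' j t 0)) t := fun t => by
      refine (hd t 1).congr_deriv ?_
      simp [cross, q2]; ring
    have h2 : ∀ t, HasDerivAt (fun t => p j t 2 - p' j t 2) 0 t := fun t => by
      refine (hd t 2).congr_deriv ?_
      simp [cross, q2]
    have h1c : ∀ t, HasDerivAt (fun t => conj (p j t 1 - p' j t 1))
        (-j * (p j t 0 - p' j t 0)) t := fun t => by
      refine (hasDerivAt_conj (h1 t)).congr_deriv ?_
      simp
    have hcont : ∀ i, Continuous fun t => p j t i - p' j t i := fun i =>
      (h.continuous hk hjk i).sub (h'.continuous hk hjk i)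
    have hcoeff : ∀ (i : Fin 3) (m : ℤ), coeff (fun t => p j t i) m = coeff (fun t => p' j t i) m →
        coeff (fun t => p j t i - p' j t i) m = 0 := fun i m hm => by
      rw [coeff_sub (h.continuous hk hjk i) (h'.continuous hk hjk i), hm, sub_self]
    have hconst : ∀ i : Fin 3, (∀ t, HasDerivAt (fun t => p j t i - p' j t i) 0 t) →
        coeff (fun t => p j t i) 0 = coeff (fun t => p' j t i) 0 →
        ∀ t, p j t i = p' j t i := fun i hi hc t => by
      have e : ∀ t, p j t i - p' j t i = p j 0 i - p' j 0 i := fun t =>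
        is_const_of_deriv_eq_zero (fun t => (hi t).differentiableAt) (fun t => (hi t).deriv) t 0
      have := hcoeff i 0 hc
      simp only [e, coeff_const] at this
      rw [← sub_eq_zero, e, this]
    -- At level 0 all three coordinates of the difference are constant, so the constant terms
    -- determine them.
    rcases Nat.eq_zero_or_pos j with rfl | hj0
    · funext t
      ext i
      refine hconst i (fun t => ?_) ((h.2.coeff_zero i).trans (h'.2.coeff_zero i).symm) t
      refine (hd t i).congr_deriv ?_
      simp
    · have hP : ∀ t, p j t 0 - p' j t 0 - Complex.I * conj (p j t 1 - p' j t 1) =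
          (p j 0 0 - p' j 0 0 - Complex.I * conj (p j 0 1 - p' j 0 1)) *
            Complex.exp (Complex.I * (j : ℤ) * t) := fun t => by
        refine eq_exp_of_hasDerivAt (m := j) (f := fun t => p j t 0 - p' j t 0 -
          Complex.I * conj (p j t 1 - p' j t 1)) (fun t => ?_) t
        refine ((h0 t).sub ((h1c t).const_mul Complex.I)).congr_deriv ?_
        push_cast
        linear_combination (j * conj (p j t 1 - p' j t 1)) * hI
      have hQ : ∀ t, p j t 0 - p' j t 0 + Complex.I * conj (p j t 1 - p' j t 1) =
          (p j 0 0 - p' j 0 0 + Complex.I * conj (p j 0 1 - p' j 0 1)) *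
            Complex.exp (Complex.I * (-j : ℤ) * t) := fun t => by
        refine eq_exp_of_hasDerivAt (m := -j) (f := fun t => p j t 0 - p' j t 0 +
          Complex.I * conj (p j t 1 - p' j t 1)) (fun t => ?_) t
        refine ((h0 t).add ((h1c t).const_mul Complex.I)).congr_deriv ?_
        push_cast
        linear_combination (j * conj (p j t 1 - p' j t 1)) * hI
      set P := p j 0 0 - p' j 0 0 - Complex.I * conj (p j 0 1 - p' j 0 1)
      set Q := p j 0 0 - p' j 0 0 + Complex.I * conj (p j 0 1 - p' j 0 1)
      have hPQ : ∀ t, p j t 0 - p' j t 0 = P / 2 * Complex.exp (Complex.I * (j : ℤ) * t) +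
          Q / 2 * Complex.exp (Complex.I * (-j : ℤ) * t) := fun t => by
        linear_combination (hP t + hQ t) / 2
      have hA := hcoeff 0 j ((h.2.coeff_A j hj0 hjk).trans (h'.2.coeff_A j hj0 hjk).symm)
      have hB := hcoeff 0 (-j) ((h.2.coeff_B j hj0 hjk).trans (h'.2.coeff_B j hj0 hjk).symm)
      simp only [hPQ] at hA hB
      rw [coeff_add (by fun_prop) (by fun_prop), coeff_const_mul, coeff_const_mul, coeff_exp,
        coeff_exp] at hA hB
      rw [if_pos rfl, if_neg (by omega)] at hA
      rw [if_neg (by omega), if_pos rfl] at hB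
      have hP0 : P = 0 := by simpa using hA
      have hQ0 : Q = 0 := by simpa using hB
      have e0 : ∀ t, p j t 0 = p' j t 0 := fun t => by
        rw [← sub_eq_zero, hPQ, hP0, hQ0]; simp
      have e1 : ∀ t, p j t 1 = p' j t 1 := fun t => by
        have := hQ t
        rw [hQ0, e0 t] at this
        exact (starRingEnd ℂ).injective (by simpa [sub_eq_zero] using this)
      have e2 := hconst 2 h2 ((h.2.coeff_C j hj0 hjk).trans (h'.2.coeff_C j hj0 hjk).symm)
      funext t
      ext i
      fin_cases i
      · exact e0 t
      · exact e1 t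
      · exact e2 t

lemma existsUnique_isMember {k : ℕ} (hk : 1 ≤ k) (c : Params k) :
    ∃! p : ℕ → ℝ → C3, IsMember k c p :=
  ⟨sol c, isMember_sol c, fun _ h => h.unique hk (isMember_sol c)⟩

/-! ### Behaviour under t ↦ t + π and t ↦ t + 2π -/

section Periodicity

/-- The wave changes by a sign depending on l, but p_j must change by one depending on j only; the
two agree wherever the mode is nonzero, by parity. -/
lemma modeCoeff_mul_neg_one_zpow (τ : ℝ) (l j : ℕ) (m : ℤ) :
    ((-1 : ℝ) ^ ((l : ℤ) + m)) * modeCoeff τ l j = (-1) ^ ((j : ℤ) + m) * modeCoeff τ l j := by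
  by_cases h : modeCoeff τ l j = 0
  · simp [h]
  · obtain ⟨i, rfl⟩ := exists_of_modeCoeff_ne_zero h
    congr 1
    push_cast
    rw [show (j : ℤ) + 2 * i + m = (j + m) + 2 * i by ring, zpow_add₀ (by norm_num), zpow_mul]
    simp

lemma modeF_add_pi (m : ℤ) (l : ℕ) (α : ℂ) (j : ℕ) (t : ℝ) :
    modeF m l α j (t + Real.pi) = ((-1 : ℝ) ^ ((j : ℤ) + m) : ℝ) * modeF m l α j t := by
  have h := modeCoeff_mul_neg_one_zpow m l j m
  have hw : wave m l α (t + Real.pi) = ((-1 : ℝ) ^ ((l : ℤ) + m) : ℝ) * wave m l α t := by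
    rw [wave_add_pi]; push_cast; rfl
  have h' : (((-1 : ℝ) ^ ((l : ℤ) + m) : ℝ) : ℂ) * modeCoeff m l j =
    ((-1 : ℝ) ^ ((j : ℤ) + m) : ℝ) * modeCoeff m l j := by exact_mod_cast h
  rw [modeF, modeF, hw, Complex.re_ofReal_mul, Complex.im_ofReal_mul]
  push_cast at h' ⊢
  linear_combination ((wave m l α t).re + Complex.I * (((j + m) / (l + m) *
    (wave m l α t).im : ℂ))) * h'

lemma modeG_add_pi (m : ℤ) (l : ℕ) (α : ℂ) (j : ℕ) (t : ℝ) :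
    modeG m l α j (t + Real.pi) = (-1 : ℝ) ^ ((j : ℤ) + 1 + m) * modeG m l α j t := by
  have h := modeCoeff_mul_neg_one_zpow m l (j + 1) m
  have hw : wave m l α (t + Real.pi) = ((-1 : ℝ) ^ ((l : ℤ) + m) : ℝ) * wave m l α t := by
    rw [wave_add_pi]; push_cast; rfl
  rw [modeG, modeG, hw, Complex.im_ofReal_mul]
  push_cast at h
  linear_combination (-((j + 1) / (l + m)) * (wave m l α t).im) * h

variable {k : ℕ} (c : Params k) (j : ℕ) (t : ℝ)

lemma neg_one_zpow_sub_one : (-1 : ℝ) ^ ((j : ℤ) + (-1 : ℤ)) = -(-1) ^ j := by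
  rw [zpow_add₀ (by norm_num)]; simp

lemma neg_one_zpow_add_one : (-1 : ℝ) ^ ((j : ℤ) + 1) = -(-1) ^ j := by
  rw [zpow_add₀ (by norm_num)]; simp

lemma solS_add_pi : solS c j (t + Real.pi) = -(-1) ^ j * solS c j t := by
  rw [solS, solS, Finset.mul_sum]
  refine Finset.sum_congr rfl fun l _ => ?_
  have := modeF_add_pi (-1) l (2 * c.A l) j t
  rw [neg_one_zpow_sub_one] at this
  push_cast at this
  exact this

lemma solH_add_pi : solH c j (t + Real.pi) = -(-1) ^ j * solH c j t := by
  rw [solH, solH, Finset.mul_sum]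
  refine Finset.sum_congr rfl fun l _ => ?_
  have := modeF_add_pi 1 l (c.beta l) j t
  rw [neg_one_zpow_add_one] at this
  push_cast at this
  exact this

lemma solEta_add_pi : solEta c j (t + Real.pi) = (-1) ^ j * solEta c j t := by
  rw [solEta, solEta, Finset.mul_sum]
  refine Finset.sum_congr rfl fun l _ => ?_
  have := modeG_add_pi (-1) l (2 * c.A l) j t
  rw [show (j : ℤ) + 1 + -1 = j by ring, zpow_natCast] at this
  push_cast at this
  exact this

lemma solRho_add_pi : solRho c j (t + Real.pi) = (-1) ^ j * solRho c j t := by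
  rw [solRho, solRho, Finset.mul_sum]
  refine Finset.sum_congr rfl fun l _ => ?_
  have := modeG_add_pi 1 l (c.beta l) j t
  rw [show (j : ℤ) + 1 + 1 = j + 2 * (1 : ℕ) by ring, zpow_add₀ (by norm_num), zpow_natCast,
    zpow_mul] at this
  push_cast at this
  simpa using this

lemma exp_I_mul_add_pi : Complex.exp (Complex.I * (t + Real.pi : ℝ)) =
    -Complex.exp (Complex.I * t) := by
  push_cast
  rw [mul_add, Complex.exp_add, mul_comm Complex.I (Real.pi : ℂ), Complex.exp_pi_mul_I]; ring

lemma exp_neg_I_mul_add_pi : Complex.exp (-(Complex.I * (t + Real.pi : ℝ))) =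
    -Complex.exp (-(Complex.I * t)) := by
  rw [← conj_exp_I_mul, exp_I_mul_add_pi, map_neg, conj_exp_I_mul]

lemma sol_add_pi : sol c j (t + Real.pi) = ((-1) ^ j : ℝ) • sol c j t := by
  ext i
  fin_cases i
  · simp only [sol, exp_I_mul_add_pi, solS_add_pi, solH_add_pi]
    simp
    ring
  · simp only [sol, exp_neg_I_mul_add_pi, solS_add_pi, solH_add_pi]
    simp
    ring
  · simp only [sol, solEta_add_pi, solRho_add_pi]
    simp
    ring

lemma q1_add_pi : q1 (t + Real.pi) = -q1 t := by
  ext i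
  fin_cases i <;> simp [q1, -Complex.ofReal_add, exp_I_mul_add_pi, exp_neg_I_mul_add_pi]

lemma Phi_add_pi (x y : ℝ) : Phi k (sol c) (x, y, t + Real.pi) = Phi k (sol c) (-x, -y, t) := by
  have h : ∀ j, x ^ j • ((-1) ^ j : ℝ) • sol c j t = (-x) ^ j • sol c j t := fun j => by
    rw [smul_smul, neg_pow x, mul_comm]
  simp only [Phi, sol_add_pi, q1_add_pi, smul_neg, neg_smul, neg_mul_neg, q2, h]

lemma Phi_add_two_pi (x y : ℝ) :
    Phi k (sol c) (x, y, t + 2 * Real.pi) = Phi k (sol c) (x, y, t) := by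
  rw [two_mul, ← add_assoc, Phi_add_pi, Phi_add_pi, neg_neg, neg_neg]

end Periodicity

/-! ### Smoothness -/

section Smooth

lemma contDiff_C3 {E : Type*} [NormedAddCommGroup E] [NormedSpace ℝ E] {n : WithTop ℕ∞}
    {f : E → C3} (h : ∀ i, ContDiff ℝ n fun x => f x i) : ContDiff ℝ n f :=
  contDiff_piLp' 2 h

lemma contDiff_conj {E : Type*} [NormedAddCommGroup E] [NormedSpace ℝ E] {n : WithTop ℕ∞}
    {f : E → ℂ} (h : ContDiff ℝ n f) : ContDiff ℝ n fun x => conj (f x) :=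
  Complex.conjCLE.contDiff.comp h

lemma contDiff_ofReal {E : Type*} [NormedAddCommGroup E] [NormedSpace ℝ E] {n : WithTop ℕ∞}
    {f : E → ℝ} (h : ContDiff ℝ n f) : ContDiff ℝ n fun x => (f x : ℂ) :=
  Complex.ofRealCLM.contDiff.comp h

lemma contDiff_wave (τ : ℝ) (l : ℕ) (α : ℂ) {n : WithTop ℕ∞} : ContDiff ℝ n (wave τ l α) :=
  contDiff_const.mul (contDiff_const.mul (contDiff_const.mul (contDiff_ofReal contDiff_id))).cexp

lemma contDiff_wave_re (τ : ℝ) (l : ℕ) (α : ℂ) {n : WithTop ℕ∞} :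
    ContDiff ℝ n fun t => (wave τ l α t).re :=
  Complex.reCLM.contDiff.comp (contDiff_wave τ l α)

lemma contDiff_wave_im (τ : ℝ) (l : ℕ) (α : ℂ) {n : WithTop ℕ∞} :
    ContDiff ℝ n fun t => (wave τ l α t).im :=
  Complex.imCLM.contDiff.comp (contDiff_wave τ l α)

lemma contDiff_modeF (τ : ℝ) (l : ℕ) (α : ℂ) (j : ℕ) {n : WithTop ℕ∞} :
    ContDiff ℝ n (modeF τ l α j) :=
  contDiff_const.mul ((contDiff_ofReal (contDiff_wave_re τ l α)).add
    (contDiff_const.mul (contDiff_ofReal (contDiff_const.mul (contDiff_wave_im τ l α)))))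

lemma contDiff_modeG (τ : ℝ) (l : ℕ) (α : ℂ) (j : ℕ) {n : WithTop ℕ∞} :
    ContDiff ℝ n (modeG τ l α j) :=
  contDiff_const.mul (contDiff_wave_im τ l α)

variable {k : ℕ} (c : Params k) (j : ℕ) {n : WithTop ℕ∞}

lemma contDiff_solS : ContDiff ℝ n (solS c j) := ContDiff.sum fun _ _ => contDiff_modeF _ _ _ _

lemma contDiff_solH : ContDiff ℝ n (solH c j) := ContDiff.sum fun _ _ => contDiff_modeF _ _ _ _

lemma contDiff_solEta : ContDiff ℝ n (solEta c j) := ContDiff.sum fun _ _ => contDiff_modeG _ _ _ _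

lemma contDiff_solRho : ContDiff ℝ n (solRho c j) := ContDiff.sum fun _ _ => contDiff_modeG _ _ _ _

lemma contDiff_exp_I_mul : ContDiff ℝ n fun t : ℝ => Complex.exp (Complex.I * t) :=
  (contDiff_const.mul (contDiff_ofReal contDiff_id)).cexp

lemma contDiff_exp_neg_I_mul : ContDiff ℝ n fun t : ℝ => Complex.exp (-(Complex.I * t)) :=
  (contDiff_const.mul (contDiff_ofReal contDiff_id)).neg.cexp

lemma contDiff_sol : ContDiff ℝ n (sol c j) := by
  refine contDiff_C3 fun i => ?_
  have hS := contDiff_solS c j (n := n)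
  have hH := contDiff_solH c j (n := n)
  fin_cases i
  · exact contDiff_exp_I_mul.mul ((hS.add (contDiff_const.mul (contDiff_conj hH))).div_const 2)
  · exact contDiff_exp_neg_I_mul.mul ((hH.sub (contDiff_const.mul (contDiff_conj hS))).div_const 2)
  · exact (contDiff_ofReal (contDiff_solRho c j)).add
      (contDiff_const.mul (contDiff_ofReal (contDiff_solEta c j)))

lemma contDiff_q1 : ContDiff ℝ n q1 := by
  refine contDiff_C3 fun i => ?_
  fin_cases i
  · exact contDiff_exp_I_mul
  · exact contDiff_const.mul contDiff_exp_neg_I_mul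
  · exact contDiff_const

lemma contDiff_Phi : ContDiff ℝ n (Phi k (sol c)) := by
  unfold Phi
  have hs : ∀ j, ContDiff ℝ n fun z : ℝ × ℝ × ℝ => sol c j z.2.2 := fun j =>
    (contDiff_sol c j).comp (contDiff_snd.comp contDiff_snd)
  have hq : ContDiff ℝ n fun z : ℝ × ℝ × ℝ => q1 z.2.2 :=
    contDiff_q1.comp (contDiff_snd.comp contDiff_snd)
  refine ((ContDiff.sum fun j _ => (contDiff_fst.pow j).smul (hs j)).add
    ((contDiff_fst.comp contDiff_snd).smul hq)).add
    ((contDiff_fst.mul (contDiff_fst.comp contDiff_snd)).smul contDiff_const)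

end Smooth

/-! ### Linear algebra of special Lagrangian frames -/

/-- The cross product as a real bilinear map. -/
def crossL : C3 →ₗ[ℝ] C3 →ₗ[ℝ] C3 :=
  LinearMap.mk₂ ℝ cross
    (fun a b s => by ext i; fin_cases i <;> simp [cross] <;> ring)
    (fun r a s => by ext i; fin_cases i <;> simp [cross] <;> ring)
    (fun a b s => by ext i; fin_cases i <;> simp [cross] <;> ring)
    (fun r a s => by ext i; fin_cases i <;> simp [cross] <;> ring)

/-- The Kähler form as a real bilinear map. -/
def kahlerL : C3 →ₗ[ℝ] C3 →ₗ[ℝ] ℝ :=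
  LinearMap.mk₂ ℝ kahlerForm
    (fun a b s => by simp [kahlerForm, Fin.sum_univ_three]; ring)
    (fun r a s => by simp [kahlerForm, Fin.sum_univ_three]; ring)
    (fun a b s => by simp [kahlerForm, Fin.sum_univ_three]; ring)
    (fun r a s => by simp [kahlerForm, Fin.sum_univ_three]; ring)

lemma crossL_apply (r s : C3) : crossL r s = cross r s := rfl

lemma kahlerL_apply (r s : C3) : kahlerL r s = kahlerForm r s := rfl

lemma cross_self (r : C3) : cross r r = 0 := by
  ext i; fin_cases i <;> simp [cross] <;> ring_nf

lemma cross_swap (r s : C3) : cross r s = -cross s r := by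
  ext i; fin_cases i <;> simp [cross] <;> ring

lemma kahlerForm_swap (r s : C3) : kahlerForm r s = -kahlerForm s r := by
  simp [kahlerForm, Fin.sum_univ_three]; ring

lemma kahlerForm_self (r : C3) : kahlerForm r r = 0 := by
  have := kahlerForm_swap r r; linarith

/-- Vectors that span an isotropic subspace and have real holomorphic volume are special
Lagrangian, up to orientation. -/
lemma abs_holVol_re_eq_vol3 {w : Fin 3 → C3} (hω : ∀ i j, kahlerForm (w i) (w j) = 0)
    (him : (holVol w).im = 0) : |(holVol w).re| = vol3 w := by
  set W : Matrix (Fin 3) (Fin 3) ℂ := Matrix.of fun i j => w i j with hW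
  -- Isotropy makes the Hermitian products real, so the Gram matrix of g is conj(W)·Wᵀ and its
  -- determinant is |Ω|², which is (Re Ω)² as Im Ω = 0.
  have hG : (Matrix.of fun i j => metric (w i) (w j)).map Complex.ofRealHom =
      W.map (starRingEnd ℂ) * W.transpose := by
    ext i j
    have h : (∑ l, conj (w i l) * w j l) = (metric (w i) (w j) : ℂ) :=
      Complex.ext rfl (by simpa [kahlerForm] using hω i j)
    simp only [Matrix.map_apply, Matrix.mul_apply, Matrix.transpose_apply, Matrix.of_apply, hW,
      Complex.ofRealHom_eq_coe]
    exact h.symm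
  have hd : (((Matrix.of fun i j => metric (w i) (w j)).det : ℝ) : ℂ) = conj W.det * W.det := by
    have h1 := Complex.ofRealHom.map_det (Matrix.of fun i j => metric (w i) (w j))
    have h2 := (starRingEnd ℂ).map_det W
    rw [RingHom.mapMatrix_apply] at h1 h2
    rw [hG, Matrix.det_mul, Matrix.det_transpose, ← h2] at h1
    exact h1
  have hd' : (Matrix.of fun i j => metric (w i) (w j)).det = (holVol w).re ^ 2 := by
    have h3 := congrArg Complex.re hd
    rw [Complex.ofReal_re] at h3
    rw [h3]
    change (conj (holVol w) * holVol w).re = _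
    simp [him]; ring
  rw [vol3, hd', Real.sqrt_sq_eq_abs]

/-- The frame `X, Y, 2 X × Y` with `ω(X,Y) = 0` spans a special Lagrangian plane. -/
lemma abs_holVol_re_eq_vol3_of_frame {X Y : C3} (h : kahlerForm X Y = 0)
    (m : Fin 3 → ℝ × ℝ × ℝ) {w : Fin 3 → C3}
    (hw : ∀ i, w i = (m i).1 • X + (m i).2.1 • Y + (m i).2.2 • (2 : ℝ) • cross X Y) :
    |(holVol w).re| = vol3 w := by
  set Z := (2 : ℝ) • cross X Y with hZ
  have h2 : conj (2 : ℂ) = 2 := Complex.conj_ofNat 2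
  -- The product X × Y is the conjugate of half the ordinary complex cross product, hence
  -- Hermitian-orthogonal to X and to Y.
  have hXZ : kahlerForm X Z = 0 := by
    have : ∑ j, conj (X j) * Z j = 0 := by
      simp [hZ, cross, Fin.sum_univ_three]; ring
    rw [kahlerForm, this]; rfl
  have hYZ : kahlerForm Y Z = 0 := by
    have : ∑ j, conj (Y j) * Z j = 0 := by
      simp [hZ, cross, Fin.sum_univ_three]; ring
    rw [kahlerForm, this]; rfl
  refine abs_holVol_re_eq_vol3 (fun i j => ?_) ?_
  · have h' := kahlerForm_swap Y X
    have hZX := kahlerForm_swap Z X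
    have hZY := kahlerForm_swap Z Y
    rw [h, neg_zero] at h'
    rw [hXZ, neg_zero] at hZX
    rw [hYZ, neg_zero] at hZY
    rw [hw, hw, ← kahlerL_apply]
    simp only [map_add, LinearMap.add_apply, map_smul, LinearMap.smul_apply, kahlerL_apply,
      kahlerForm_self, h, h', hXZ, hYZ, hZX, hZY, smul_zero, add_zero]
  · have hdet : holVol w = ((Matrix.of fun i j => ![(m i).1, (m i).2.1, (m i).2.2] j).det : ℝ) *
        holVol ![X, Y, Z] := by
      have h1 := Complex.ofRealHom.map_det
        (Matrix.of fun i j => ![(m i).1, (m i).2.1, (m i).2.2] j)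
      rw [RingHom.mapMatrix_apply] at h1
      change ((Matrix.det _ : ℝ) : ℂ) = _ at h1
      rw [h1, holVol, holVol, ← Matrix.det_mul]
      congr 1
      ext i j
      rw [Matrix.mul_apply, Fin.sum_univ_three]
      simp [hw]
    -- For the same reason Ω(X, Y, 2 X×Y) is the sum of the squared moduli of the 2×2 minors of
    -- (X,Y), a real number.
    have hreal : holVol ![X, Y, Z] = ((Complex.normSq (X 1 * Y 2 - X 2 * Y 1) +
        Complex.normSq (X 2 * Y 0 - X 0 * Y 2) + Complex.normSq (X 0 * Y 1 - X 1 * Y 0) : ℝ) : ℂ) := by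
      rw [holVol, Matrix.det_fin_three]
      push_cast
      simp only [Complex.normSq_eq_conj_mul_self]
      simp [hZ, cross]
      ring
    rw [hdet, hreal, ← Complex.ofReal_mul, Complex.ofReal_im]

/-- If `X` is not a real multiple of `Y ≠ 0` and `ω(X,Y) = 0`, then `X, Y, 2 X × Y` are
linearly independent. -/
lemma frame_injective {X Y : C3} (h : kahlerForm X Y = 0) (hY : Y ≠ 0)
    (hX : ∀ r : ℝ, X ≠ r • Y) {a b d : ℝ}
    (h0 : a • X + b • Y + d • (2 : ℝ) • cross X Y = 0) : a = 0 ∧ b = 0 ∧ d = 0 := by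
  have hn : ∀ i, a * X i + b * Y i + d * (2 * cross X Y i) = 0 := fun i => by
    have := congrArg (fun v : C3 => v i) h0
    simpa using this
  set u := X 1 * Y 2 - X 2 * Y 1 with hu
  set v := X 2 * Y 0 - X 0 * Y 2 with hv
  set w := X 0 * Y 1 - X 1 * Y 0 with hw
  have c0 : 2 * cross X Y 0 = conj u := by simp [cross, hu]
  have c1 : 2 * cross X Y 1 = conj v := by simp [cross, hv]
  have c2 : 2 * cross X Y 2 = conj w := by simp [cross, hw]
  have e0 := hn 0
  have e1 := hn 1
  have e2 := hn 2
  rw [c0] at e0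
  rw [c1] at e1
  rw [c2] at e2
  -- Pair the relation bilinearly with the ordinary cross product (u,v,w), which annihilates X and
  -- Y.
  have hsum : (d : ℂ) * (u * conj u + v * conj v + w * conj w) = 0 := by
    linear_combination u * e0 + v * e1 + w * e2
  have hd : d = 0 := by
    by_contra hd
    have hs : u * conj u + v * conj v + w * conj w = 0 :=
      (mul_eq_zero.1 hsum).resolve_left (by exact_mod_cast hd)
    rw [Complex.mul_conj, Complex.mul_conj, Complex.mul_conj] at hs
    have hs' : Complex.normSq u + Complex.normSq v + Complex.normSq w = 0 := by exact_mod_cast hs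
    have nu := Complex.normSq_nonneg u
    have nv := Complex.normSq_nonneg v
    have nw := Complex.normSq_nonneg w
    have hu0 : u = 0 := Complex.normSq_eq_zero.1 (by linarith)
    have hv0 : v = 0 := Complex.normSq_eq_zero.1 (by linarith)
    have hw0 : w = 0 := Complex.normSq_eq_zero.1 (by linarith)
    set N : ℝ := Complex.normSq (Y 0) + Complex.normSq (Y 1) + Complex.normSq (Y 2) with hN
    have hNc : (N : ℂ) = conj (Y 0) * Y 0 + conj (Y 1) * Y 1 + conj (Y 2) * Y 2 := by
      rw [hN]; push_cast; simp only [Complex.normSq_eq_conj_mul_self]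
    have hN0 : N ≠ 0 := by
      intro hN0
      have y0 := Complex.normSq_nonneg (Y 0)
      have y1 := Complex.normSq_nonneg (Y 1)
      have y2 := Complex.normSq_nonneg (Y 2)
      have z0 : Y 0 = 0 := Complex.normSq_eq_zero.1 (by linarith)
      have z1 : Y 1 = 0 := Complex.normSq_eq_zero.1 (by linarith)
      have z2 : Y 2 = 0 := Complex.normSq_eq_zero.1 (by linarith)
      apply hY
      ext i
      fin_cases i
      · exact z0
      · exact z1
      · exact z2
    have hNc0 : (N : ℂ) ≠ 0 := by exact_mod_cast hN0
    have hq : (∑ j, conj (Y j) * X j) = (metric Y X : ℂ) := by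
      refine Complex.ext rfl ?_
      have := kahlerForm_swap Y X
      rw [h, neg_zero] at this
      simpa [kahlerForm] using this
    rw [Fin.sum_univ_three] at hq
    -- All minors vanish, so X is the complex multiple ⟨Y,X⟩/|Y|² of Y; ω(X,Y) = 0 makes this factor
    -- real, contrary to the hypothesis on X.
    refine hX (metric Y X / N) ?_
    ext i
    have key : (N : ℂ) * X i = (metric Y X : ℂ) * Y i := by
      rw [hNc, ← hq]
      fin_cases i
      · change _ * X 0 = _ * Y 0
        linear_combination conj (Y 1) * hw0 - conj (Y 2) * hv0
      · change _ * X 1 = _ * Y 1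
        linear_combination conj (Y 2) * hu0 - conj (Y 0) * hw0
      · change _ * X 2 = _ * Y 2
        linear_combination conj (Y 0) * hv0 - conj (Y 1) * hu0
    simp only [PiLp.smul_apply, Complex.real_smul, Complex.ofReal_div]
    field_simp
    linear_combination key
  subst hd
  have h1 : a • X + b • Y = 0 := by simpa using h0
  have ha : a = 0 := by
    by_contra ha
    refine hX (-(b / a)) ?_
    have : a • X = -(b • Y) := eq_neg_of_add_eq_zero_left h1
    rw [neg_smul, div_eq_inv_mul, mul_smul, ← smul_neg, ← this, smul_smul, inv_mul_cancel₀ ha,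
      one_smul]
  subst ha
  refine ⟨rfl, ?_, rfl⟩
  have : b • Y = 0 := by simpa using h1
  exact (smul_eq_zero.1 this).resolve_right hY

/-! ### The differential of Φ -/

section Frame
variable {k : ℕ} (c : Params k) (x y t : ℝ)

/-- The derivative of `Φ` in the `x` direction. -/
def frameX : C3 := (∑ j ∈ Finset.range (k + 1), (j * x ^ (j - 1)) • sol c j t) + y • q2 t

/-- The derivative of `Φ` in the `y` direction. -/
def frameY : C3 := q1 t + x • q2 t

lemma hasDerivAt_Phi_x : HasDerivAt (fun x => Phi k (sol c) (x, y, t)) (frameX c x y t) x := by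
  have h1 : HasDerivAt (fun x : ℝ => ∑ j ∈ Finset.range (k + 1), x ^ j • sol c j t)
      (∑ j ∈ Finset.range (k + 1), (j * x ^ (j - 1)) • sol c j t) x :=
    HasDerivAt.fun_sum fun j _ => (hasDerivAt_pow j x).smul_const _
  have h2 : HasDerivAt (fun x : ℝ => (x * y) • q2 t) (y • q2 t) x := by
    simpa using! ((hasDerivAt_id x).mul_const y).smul_const (q2 t)
  exact (h1.add_const (y • q1 t)).fun_add h2

lemma hasDerivAt_Phi_y : HasDerivAt (fun y => Phi k (sol c) (x, y, t)) (frameY x t) y := by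
  have h1 : HasDerivAt (fun y : ℝ => y • q1 t) (q1 t) y := by
    simpa using! (hasDerivAt_id y).smul_const (q1 t)
  have h2 : HasDerivAt (fun y : ℝ => (x * y) • q2 t) (x • q2 t) y := by
    simpa using! ((hasDerivAt_id y).const_mul x).smul_const (q2 t)
  exact (h1.const_add (∑ j ∈ Finset.range (k + 1), x ^ j • sol c j t)).fun_add h2

/-- The evolution equations are the coefficients of this identity when it is expanded in powers of x
and y. -/
lemma hasDerivAt_Phi_t : HasDerivAt (fun t => Phi k (sol c) (x, y, t))
    ((2 : ℝ) • cross (frameX c x y t) (frameY x t)) t := by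
  have hev := isEvolution_sol c
  have h1 : HasDerivAt (fun t : ℝ => ∑ j ∈ Finset.range (k + 1), x ^ j • sol c j t)
      (∑ j ∈ Finset.range (k + 1), x ^ j • ((2 * (j + 1) : ℝ) • cross (sol c (j + 1) t) (q1 t) +
        (2 * j : ℝ) • cross (sol c j t) (q2 t))) t :=
    HasDerivAt.fun_sum fun j _ => (hasDerivAt_sol c j t).fun_const_smul (x ^ j)
  have h2 := (hev.deriv_q_one t).fun_const_smul y
  have h3 := (hev.deriv_q_two t).fun_const_smul (x * y)
  refine ((h1.fun_add h2).fun_add h3).congr_deriv ?_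
  -- Reindexing by j ↦ j+1 creates a term at k+1, which is zero because p_{k+1} = 0.
  have hshift : ∑ j ∈ Finset.range (k + 1), x ^ j • (2 * (j + 1) : ℝ) •
        cross (sol c (j + 1) t) (q1 t) =
      ∑ j ∈ Finset.range (k + 1), (2 * (j * x ^ (j - 1)) : ℝ) • cross (sol c j t) (q1 t) := by
    have e := Finset.sum_range_succ' (fun j => (2 * (j * x ^ (j - 1)) : ℝ) •
      cross (sol c j t) (q1 t)) (k + 1)
    rw [Finset.sum_range_succ, hev.p_eq_zero (k + 1) (Nat.lt_succ_self k)] at e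
    simp only [Pi.zero_apply, cross_zero_left, smul_zero, add_zero, Nat.cast_zero, zero_mul,
      mul_zero, zero_smul] at e
    rw [e]
    refine Finset.sum_congr rfl fun j _ => ?_
    rw [smul_smul, Nat.add_sub_cancel]
    push_cast
    ring_nf
  have hL : cross (frameX c x y t) (frameY x t) =
      (∑ j ∈ Finset.range (k + 1), (j * x ^ (j - 1)) • cross (sol c j t) (q1 t)) +
      (∑ j ∈ Finset.range (k + 1), (j * x ^ (j - 1)) • x • cross (sol c j t) (q2 t)) -
      y • cross (q1 t) (q2 t) := by
    rw [← crossL_apply, frameX, frameY]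
    simp only [map_add, map_sum, LinearMap.add_apply, map_smul, LinearMap.smul_apply,
      LinearMap.sum_apply, crossL_apply, cross_self, smul_zero, add_zero]
    rw [cross_swap (q2 t) (q1 t), smul_neg, Finset.smul_sum]
    simp only [smul_comm x]
    abel
  simp only [smul_add, Finset.sum_add_distrib]
  rw [hshift, hL, smul_sub, smul_add, Finset.smul_sum, Finset.smul_sum, smul_zero, add_zero,
    sub_eq_add_neg]
  congr 1
  · congr 1
    · refine Finset.sum_congr rfl fun j _ => ?_
      rw [smul_smul]
    · refine Finset.sum_congr rfl fun j _ => ?_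
      rw [smul_smul, smul_smul, smul_smul]
      rcases j with _ | j
      · simp
      · rw [Nat.add_sub_cancel, pow_succ]; ring_nf
  · rw [smul_smul, smul_smul, ← neg_smul]; ring_nf

/-- As a polynomial in x, the coefficient of x^{j-1} is j ω(p_j,q_1) + (j-1) ω(p_{j-1},q_2); the
leftover x^k term is removed by ω(p_k,q_2) = 0, and the y-terms by ω(q_1,q_2) = 0. -/
lemma kahlerForm_frame : kahlerForm (frameX c x y t) (frameY x t) = 0 := by
  have hev := isEvolution_sol c
  rw [← kahlerL_apply, frameX, frameY]
  simp only [map_add, map_sum, LinearMap.add_apply, map_smul, LinearMap.smul_apply,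
    LinearMap.sum_apply, kahlerL_apply, kahlerForm_self, smul_eq_mul, mul_zero, add_zero]
  rw [kahlerForm_swap (q2 t), hev.omega_q, neg_zero, mul_zero, add_zero]
  have h1 : ∑ j ∈ Finset.range (k + 1), j * x ^ (j - 1) * kahlerForm (sol c j t) (q1 t) =
      -∑ j ∈ Finset.range k, j * x ^ j * kahlerForm (sol c j t) (q2 t) := by
    rw [Finset.sum_range_succ', ← Finset.sum_neg_distrib]
    simp only [Nat.cast_zero, zero_mul, add_zero]
    refine Finset.sum_congr rfl fun j hj => ?_
    have := hev.omega_mid (j + 1) (by omega) (by have := Finset.mem_range.1 hj; omega) t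
    rw [Nat.add_sub_cancel] at this ⊢
    push_cast at this ⊢
    linear_combination x ^ j * this
  have h2 : ∑ j ∈ Finset.range (k + 1), j * x ^ (j - 1) * (x * kahlerForm (sol c j t) (q2 t)) =
      ∑ j ∈ Finset.range k, j * x ^ j * kahlerForm (sol c j t) (q2 t) := by
    rw [Finset.sum_range_succ, hev.omega_top, mul_zero, mul_zero, add_zero]
    refine Finset.sum_congr rfl fun j _ => ?_
    rcases j with _ | j
    · simp
    · rw [Nat.add_sub_cancel, pow_succ]; ring
  have h3 : x * ∑ j ∈ Finset.range (k + 1), j * x ^ (j - 1) * kahlerForm (sol c j t) (q2 t) =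
      ∑ j ∈ Finset.range k, j * x ^ j * kahlerForm (sol c j t) (q2 t) := by
    rw [← h2, Finset.mul_sum]
    exact Finset.sum_congr rfl fun j _ => by ring
  rw [h1, h3]
  ring

lemma frameY_ne_zero : frameY x t ≠ 0 := fun h => by
  have := congrArg (fun v : C3 => v 0) h
  simp [frameY, q1, q2] at this

lemma fderiv_Phi_apply (z v : ℝ × ℝ × ℝ) : fderiv ℝ (Phi k (sol c)) z v =
    v.1 • frameX c z.1 z.2.1 z.2.2 + v.2.1 • frameY z.1 z.2.2 +
      v.2.2 • (2 : ℝ) • cross (frameX c z.1 z.2.1 z.2.2) (frameY z.1 z.2.2) := by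
  obtain ⟨x, y, t⟩ := z
  obtain ⟨a, b, d⟩ := v
  have hD : HasFDerivAt (Phi k (sol c)) (fderiv ℝ (Phi k (sol c)) (x, y, t)) (x, y, t) :=
    ((contDiff_Phi c (n := 1)).differentiable (by norm_num) _).hasFDerivAt
  have ex : fderiv ℝ (Phi k (sol c)) (x, y, t) (1, 0, 0) = frameX c x y t :=
    (hD.comp_hasDerivAt (f := fun x => (x, y, t)) x ((hasDerivAt_id x).prodMk
      (hasDerivAt_const x (y, t)))).unique (hasDerivAt_Phi_x c x y t)
  have ey : fderiv ℝ (Phi k (sol c)) (x, y, t) (0, 1, 0) = frameY x t :=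
    (hD.comp_hasDerivAt (f := fun y => (x, y, t)) y ((hasDerivAt_const y x).prodMk ((hasDerivAt_id y).prodMk
      (hasDerivAt_const y t)))).unique (hasDerivAt_Phi_y c x y t)
  have et : fderiv ℝ (Phi k (sol c)) (x, y, t) (0, 0, 1) =
      (2 : ℝ) • cross (frameX c x y t) (frameY x t) :=
    (hD.comp_hasDerivAt (f := fun t => (x, y, t)) t ((hasDerivAt_const t x).prodMk ((hasDerivAt_const t y).prodMk
      (hasDerivAt_id t)))).unique (hasDerivAt_Phi_t c x y t)
  have hv : ((a, b, d) : ℝ × ℝ × ℝ) = a • (1, 0, 0) + b • (0, 1, 0) + d • (0, 0, 1) := by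
    simp
  rw [hv, map_add, map_add, map_smul, map_smul, map_smul, ex, ey, et]
  simp

lemma injective_fderiv_Phi (h : ∀ r : ℝ, frameX c x y t ≠ r • frameY x t) :
    Function.Injective (fderiv ℝ (Phi k (sol c)) (x, y, t)) := by
  refine (injective_iff_map_eq_zero _).2 fun v hv => ?_
  rw [fderiv_Phi_apply] at hv
  obtain ⟨h1, h2, h3⟩ := frame_injective (kahlerForm_frame c x y t) (frameY_ne_zero x t) h hv
  exact Prod.ext h1 (Prod.ext h2 h3)

lemma isSLTangent_fderiv_Phi (z : ℝ × ℝ × ℝ)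
    (h : Function.Injective (fderiv ℝ (Phi k (sol c)) z)) :
    IsSLTangent (fderiv ℝ (Phi k (sol c)) z) :=
  ⟨(fderiv ℝ (Phi k (sol c)) z).toLinearMap.isLinear, by simp, h, fun v =>
    abs_holVol_re_eq_vol3_of_frame (kahlerForm_frame c z.1 z.2.1 z.2.2) v
      fun i => fderiv_Phi_apply c z (v i)⟩

/-- Varying y leaves Y fixed and moves X along q_2. The first coordinate of Y is nonzero and
unaffected, so the factor r in X = rY is fixed by it, and the third coordinate then allows a single
y. -/
lemma dense_injective_fderiv_Phi :
    Dense {z : ℝ × ℝ × ℝ | Function.Injective (fderiv ℝ (Phi k (sol c)) z)} := by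
  rintro ⟨x, y, t⟩
  by_cases h : ∃ r : ℝ, frameX c x y t = r • frameY x t
  · obtain ⟨r, hr⟩ := h
    have hgood : ∀ y' ∈ ({y}ᶜ : Set ℝ),
        (x, y', t) ∈ {z : ℝ × ℝ × ℝ | Function.Injective (fderiv ℝ (Phi k (sol c)) z)} := by
      intro y' hy'
      refine injective_fderiv_Phi c x y' t fun r' hr' => hy' ?_
      have hX : frameX c x y' t = frameX c x y t + (y' - y) • q2 t := by
        simp only [frameX, sub_smul]; abel
      have h0 : r • frameY x t + (y' - y) • q2 t = r' • frameY x t := by rw [← hr, ← hX, hr']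
      have e0 := congrArg (fun v : C3 => v 0) h0
      have e2 := congrArg (fun v : C3 => v 2) h0
      simp [frameY, q1, q2] at e0 e2
      subst e0
      have e3 : ((y' : ℂ) - y) = 0 := by simpa using e2
      exact_mod_cast sub_eq_zero.1 e3
    have hcont : Continuous fun y' : ℝ => ((x, y', t) : ℝ × ℝ × ℝ) := by fun_prop
    exact closure_mono (by rintro _ ⟨y', hy', rfl⟩; exact hgood y' hy')
      (image_closure_subset_closure_image hcont ⟨y, dense_compl_singleton y y, rfl⟩)
  · push Not at h
    exact subset_closure (injective_fderiv_Phi c x y t h)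

end Frame

/-- Transfers the tangent condition from ℝ³ to the quotient, with D the derivative of the
projection. -/
lemma IsSLTangent.of_comp {V V' : Type*} [AddCommGroup V] [Module ℝ V] [AddCommGroup V']
    [Module ℝ V'] {S : V → C3} {T : V' → C3} {D : V → V'} (hS : IsSLTangent S)
    (hT : IsLinearMap ℝ T) (hV : Module.finrank ℝ V' = 3) (hD : Function.Surjective D)
    (hcomp : ∀ v, T (D v) = S v) : IsSLTangent T := by
  refine ⟨hT, hV, fun a b hab => ?_, fun v => ?_⟩
  · obtain ⟨a, rfl⟩ := hD a
    obtain ⟨b, rfl⟩ := hD b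
    rw [hcomp, hcomp] at hab
    rw [hS.2.2.1 hab]
  · choose w hw using fun i => hD (v i)
    have := hS.2.2.2 w
    simpa only [← hcomp, hw] using this

/-! ### Hausdorff dimension of a union of kernels -/

section KernelFamily
open Module Topology

variable {Z V W : Type*} [NormedAddCommGroup Z] [NormedSpace ℝ Z] [FiniteDimensional ℝ Z]
  [NormedAddCommGroup V] [NormedSpace ℝ V] [FiniteDimensional ℝ V]
  [NormedAddCommGroup W] [NormedSpace ℝ W] [FiniteDimensional ℝ W]

/-- Near a parameter at which the map is surjective, the kernels of a `C¹` family of linear maps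
sweep out a set of the expected Hausdorff dimension. -/
lemma exists_nhds_dimH_kernels_le {G : Z → V →L[ℝ] W} (hG : ContDiff ℝ 1 G) {z₀ : Z}
    (hz : Function.Surjective (G z₀)) : ∃ N ∈ 𝓝 z₀,
      dimH {v | ∃ z ∈ N, G z v = 0} ≤ (finrank ℝ Z + (finrank ℝ V - finrank ℝ W) : ℕ) := by
  obtain ⟨R, hR⟩ := (G z₀ : V →ₗ[ℝ] W).exists_rightInverse_of_surjective
    (LinearMap.range_eq_top.2 hz)
  set R' : W →L[ℝ] V := LinearMap.toContinuousLinearMap R with hR'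
  have hGR : ∀ w, G z₀ (R' w) = w := fun w => LinearMap.congr_fun hR w
  let K : Submodule ℝ V := LinearMap.ker (G z₀ : V →ₗ[ℝ] W)
  have hK : finrank ℝ K = finrank ℝ V - finrank ℝ W := by
    have h1 := (G z₀ : V →ₗ[ℝ] W).finrank_range_add_finrank_ker
    rw [LinearMap.range_eq_top.2 hz, finrank_top] at h1
    change finrank ℝ (LinearMap.ker (G z₀ : V →ₗ[ℝ] W)) = _
    omega
  -- With R' a right inverse of G z₀, this is the identity at z₀, hence invertible nearby.
  let φ : Z → W →L[ℝ] W := fun z => (G z).comp R'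
  have hφ : ContDiff ℝ 1 φ := hG.clm_comp contDiff_const
  have hφ0 : φ z₀ = 1 := by
    ext w; exact hGR w
  have hunit : {z | IsUnit (φ z)} ∈ 𝓝 z₀ := by
    refine hφ.continuous.continuousAt.preimage_mem_nhds (t := {a | IsUnit a}) ?_
    rw [hφ0]
    exact Units.isOpen.mem_nhds isUnit_one
  obtain ⟨r, hr, hball⟩ := Metric.mem_nhds_iff.1 hunit
  -- Correcting w ∈ ker (G z₀) by an element of the range of R' puts it in ker (G z). This is a C¹
  -- parametrisation of the nearby kernels by Z × ker (G z₀).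
  let Ψ : Z × K → V := fun q => (q.2 : V) - R' (Ring.inverse (φ q.1) (G q.1 q.2))
  have hΨ : ContDiffOn ℝ 1 Ψ (Metric.ball z₀ r ×ˢ Set.univ) := by
    rintro ⟨z, w⟩ ⟨hzb, -⟩
    obtain ⟨u, hu⟩ := hball hzb
    have hsub : ContDiff ℝ 1 fun q : Z × K => (q.2 : V) :=
      K.subtypeL.contDiff.comp contDiff_snd
    have hinv : ContDiffAt ℝ 1 (fun q : Z × K => Ring.inverse (φ q.1)) (z, w) := by
      have h1 : ContDiffAt ℝ 1 Ring.inverse (φ z) := hu ▸ contDiffAt_ringInverse ℝ u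
      exact h1.comp (z, w) (hφ.comp contDiff_fst).contDiffAt
    have hGq : ContDiff ℝ 1 fun q : Z × K => G q.1 q.2 := (hG.comp contDiff_fst).clm_apply hsub
    exact (hsub.contDiffAt.sub (R'.contDiff.contDiffAt.comp (z, w)
      (hinv.clm_apply hGq.contDiffAt))).contDiffWithinAt
  refine ⟨Metric.ball z₀ r, Metric.ball_mem_nhds z₀ hr, ?_⟩
  have hsubset : {v | ∃ z ∈ Metric.ball z₀ r, G z v = 0} ⊆
      Ψ '' (Metric.ball z₀ r ×ˢ Set.univ) := by
    rintro v ⟨z, hzb, hv⟩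
    refine ⟨(z, ⟨v - R' (G z₀ v), ?_⟩), ⟨hzb, trivial⟩, ?_⟩
    · change G z₀ (v - R' (G z₀ v)) = 0
      rw [map_sub, hGR, sub_self]
    · have hinv : ∀ w, Ring.inverse (φ z) (φ z w) = w := fun w => by
        have := Ring.inverse_mul_cancel (φ z) (hball hzb)
        exact congrArg (fun f : W →L[ℝ] W => f w) this
      have h1 : G z (v - R' (G z₀ v)) = φ z (-G z₀ v) := by
        rw [map_sub, hv, zero_sub, map_neg]; rfl
      change v - R' (G z₀ v) - R' (Ring.inverse (φ z) (G z (v - R' (G z₀ v)))) = v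
      rw [h1, hinv, map_neg]
      abel
  calc dimH {v | ∃ z ∈ Metric.ball z₀ r, G z v = 0}
      ≤ dimH (Ψ '' (Metric.ball z₀ r ×ˢ Set.univ)) := dimH_mono hsubset
    _ ≤ finrank ℝ (Z × K) :=
        (hΨ.dimH_image_le ((convex_ball z₀ r).prod convex_univ) subset_rfl).trans
          ((dimH_mono (Set.subset_univ _)).trans_eq (Real.dimH_univ_eq_finrank _))
    _ = _ := by rw [finrank_prod, hK]

/-- The kernels of a `C¹` family of surjective linear maps sweep out a set of the expected
Hausdorff dimension. -/
lemma dimH_kernels_le {G : Z → V →L[ℝ] W} (hG : ContDiff ℝ 1 G) {S : Set Z}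
    (hS : ∀ z ∈ S, Function.Surjective (G z)) :
    dimH {v | ∃ z ∈ S, G z v = 0} ≤ (finrank ℝ Z + (finrank ℝ V - finrank ℝ W) : ℕ) := by
  choose! N hN hdim using fun z hz => exists_nhds_dimH_kernels_le hG (hS z hz)
  -- By the Lindelöf property countably many of the neighbourhoods suffice, and Hausdorff dimension
  -- is stable under countable unions.
  obtain ⟨u, huS, huc, hcover⟩ := TopologicalSpace.countable_cover_nhdsWithin
    fun z hz => mem_nhdsWithin_of_mem_nhds (hN z hz)
  have hsub : {v | ∃ z ∈ S, G z v = 0} ⊆ ⋃ z ∈ u, {v | ∃ z' ∈ N z, G z' v = 0} := by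
    rintro v ⟨z, hz, hv⟩
    obtain ⟨z₁, hz₁, hzN⟩ := Set.mem_iUnion₂.1 (hcover hz)
    exact Set.mem_iUnion₂.2 ⟨z₁, hz₁, z, hzN, hv⟩
  refine (dimH_mono hsub).trans ?_
  rw [dimH_bUnion huc]
  exact iSup₂_le fun z hz => hdim z (huS hz)

end KernelFamily

/-! ### The degeneracy equations as linear conditions on the parameters -/

section Linear
variable {k : ℕ}

lemma Params.A_add (c c' : Params k) (l : ℕ) : (c + c').A l = c.A l + c'.A l := by
  unfold Params.A; split_ifs <;> simp

lemma Params.B_add (c c' : Params k) (l : ℕ) : (c + c').B l = c.B l + c'.B l := by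
  unfold Params.B; split_ifs <;> simp

lemma Params.A_smul (r : ℝ) (c : Params k) (l : ℕ) : (r • c).A l = r * c.A l := by
  unfold Params.A; split_ifs <;> simp

lemma Params.B_smul (r : ℝ) (c : Params k) (l : ℕ) : (r • c).B l = r * c.B l := by
  unfold Params.B; split_ifs <;> simp

lemma Params.beta_add (c c' : Params k) (l : ℕ) : (c + c').beta l = c.beta l + c'.beta l := by
  simp only [Params.beta, Params.A_add, Params.B_add, map_add]; ring

lemma Params.beta_smul (r : ℝ) (c : Params k) (l : ℕ) : (r • c).beta l = r * c.beta l := by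
  simp only [Params.beta, Params.A_smul, Params.B_smul, map_mul, Complex.conj_ofReal]; ring

lemma modeF_re_add (τ : ℝ) (l : ℕ) (α β : ℂ) (j : ℕ) (t : ℝ) :
    (modeF τ l (α + β) j t).re = (modeF τ l α j t).re + (modeF τ l β j t).re := by
  simp only [modeF_re, wave, add_mul, Complex.add_re]; ring

lemma modeF_re_smul (τ : ℝ) (l : ℕ) (r : ℝ) (α : ℂ) (j : ℕ) (t : ℝ) :
    (modeF τ l (r * α) j t).re = r * (modeF τ l α j t).re := by
  simp only [modeF_re, wave, mul_assoc, Complex.re_ofReal_mul]; ring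

lemma modeG_add (τ : ℝ) (l : ℕ) (α β : ℂ) (j : ℕ) (t : ℝ) :
    modeG τ l (α + β) j t = modeG τ l α j t + modeG τ l β j t := by
  simp only [modeG, wave, add_mul, Complex.add_im]; ring

lemma modeG_smul (τ : ℝ) (l : ℕ) (r : ℝ) (α : ℂ) (j : ℕ) (t : ℝ) :
    modeG τ l (r * α) j t = r * modeG τ l α j t := by
  simp only [modeG, wave, mul_assoc, Complex.im_ofReal_mul]; ring

/-- The real part of the component `s_j`, as a function of the parameters. -/
def solSre (j : ℕ) (t : ℝ) : Params k →ₗ[ℝ] ℝ where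
  toFun c := (solS c j t).re
  map_add' c c' := by
    simp only [solS, Complex.re_sum, Params.A_add, mul_add, modeF_re_add, Finset.sum_add_distrib]
  map_smul' r c := by
    simp only [solS, Complex.re_sum, Params.A_smul, mul_left_comm (2 : ℂ), modeF_re_smul,
      Finset.mul_sum, RingHom.id_apply, smul_eq_mul]

/-- The component `η_j`, as a function of the parameters. -/
def solEtaL (j : ℕ) (t : ℝ) : Params k →ₗ[ℝ] ℝ where
  toFun c := solEta c j t
  map_add' c c' := by
    simp only [solEta, Params.A_add, mul_add, modeG_add, Finset.sum_add_distrib]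
  map_smul' r c := by
    simp only [solEta, Params.A_smul, mul_left_comm (2 : ℂ), modeG_smul,
      Finset.mul_sum, RingHom.id_apply, smul_eq_mul]

/-- The real part of the component `h_j`, as a function of the parameters. -/
def solHre (j : ℕ) (t : ℝ) : Params k →ₗ[ℝ] ℝ where
  toFun c := (solH c j t).re
  map_add' c c' := by
    simp only [solH, Complex.re_sum, Params.beta_add, modeF_re_add, Finset.sum_add_distrib]
  map_smul' r c := by
    simp only [solH, Complex.re_sum, Params.beta_smul, modeF_re_smul,
      Finset.mul_sum, RingHom.id_apply, smul_eq_mul]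

variable (c : Params k) (x σ t : ℝ)

/-- The homogenised real part of `∂s/∂x`. -/
def degS : ℝ := ∑ j ∈ Finset.range (k + 1), j * x ^ (j - 1) * σ ^ (k - j) * (solS c j t).re

/-- The homogenised `∂η/∂x`. -/
def degEta : ℝ := ∑ j ∈ Finset.range k, j * x ^ (j - 1) * σ ^ (k - 1 - j) * solEta c j t

/-- The homogenised real part of `∂h/∂x`. -/
def degH : ℝ := ∑ j ∈ Finset.range (k + 1), j * x ^ (j - 1) * σ ^ (k - j) * (solH c j t).re

/-- The three functions whose common zeros are the points where the immersion degenerates. -/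
def degL (q : ℝ × ℝ × ℝ) : Params k →L[ℝ] ℝ × ℝ × ℝ :=
  LinearMap.toContinuousLinearMap <|
    (∑ j ∈ Finset.range (k + 1), (j * q.1 ^ (j - 1) * q.2.1 ^ (k - j)) • solSre j q.2.2).prod
    ((∑ j ∈ Finset.range k, (j * q.1 ^ (j - 1) * q.2.1 ^ (k - 1 - j)) • solEtaL j q.2.2).prod
    (∑ j ∈ Finset.range (k + 1), (j * q.1 ^ (j - 1) * q.2.1 ^ (k - j)) • solHre j q.2.2))

lemma degL_apply : degL (x, σ, t) c = (degS c x σ t, degEta c x σ t, degH c x σ t) := by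
  simp [degL, degS, degEta, degH, solSre, solEtaL, solHre]
  rfl

lemma contDiff_re {E : Type*} [NormedAddCommGroup E] [NormedSpace ℝ E] {n : WithTop ℕ∞}
    {f : E → ℂ} (h : ContDiff ℝ n f) : ContDiff ℝ n fun x => (f x).re :=
  Complex.reCLM.contDiff.comp h

lemma contDiff_degL {n : WithTop ℕ∞} : ContDiff ℝ n (degL (k := k)) := by
  refine contDiff_clm_apply_iff.2 fun c => ?_
  have hq : ∀ q : ℝ × ℝ × ℝ, degL q c = _ := fun q => degL_apply c q.1 q.2.1 q.2.2
  simp only [hq]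
  have ht : ContDiff ℝ n fun q : ℝ × ℝ × ℝ => q.2.2 := contDiff_snd.comp contDiff_snd
  have hσ : ContDiff ℝ n fun q : ℝ × ℝ × ℝ => q.2.1 := contDiff_fst.comp contDiff_snd
  refine ContDiff.prodMk (ContDiff.sum fun j _ => ?_) (ContDiff.prodMk
    (ContDiff.sum fun j _ => ?_) (ContDiff.sum fun j _ => ?_))
  · exact ((contDiff_const.mul (contDiff_fst.pow _)).mul (hσ.pow _)).mul
      (contDiff_re ((contDiff_solS c j).comp ht))
  · exact ((contDiff_const.mul (contDiff_fst.pow _)).mul (hσ.pow _)).mul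
      ((contDiff_solEta c j).comp ht)
  · exact ((contDiff_const.mul (contDiff_fst.pow _)).mul (hσ.pow _)).mul
      (contDiff_re ((contDiff_solH c j).comp ht))

/-- Homogeneity in (x,σ) replaces the x-line by a compact arc, with σ = 0 as the point at infinity.
The degree is k-1 here and for h, but k-2 for η, since η_k = 0. -/
lemma degS_scale (r : ℝ) : degS c (r * x) (r * σ) t = r ^ (k - 1) * degS c x σ t := by
  rw [degS, degS, Finset.mul_sum]
  refine Finset.sum_congr rfl fun j hj => ?_
  have hj := Finset.mem_range.1 hj
  rcases j with _ | j
  · simp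
  · rw [mul_pow, mul_pow, show k - 1 = (j + 1 - 1) + (k - (j + 1)) by omega, pow_add]; ring

lemma degH_scale (r : ℝ) : degH c (r * x) (r * σ) t = r ^ (k - 1) * degH c x σ t := by
  rw [degH, degH, Finset.mul_sum]
  refine Finset.sum_congr rfl fun j hj => ?_
  have hj := Finset.mem_range.1 hj
  rcases j with _ | j
  · simp
  · rw [mul_pow, mul_pow, show k - 1 = (j + 1 - 1) + (k - (j + 1)) by omega, pow_add]; ring

lemma degEta_scale (r : ℝ) : degEta c (r * x) (r * σ) t = r ^ (k - 2) * degEta c x σ t := by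
  rw [degEta, degEta, Finset.mul_sum]
  refine Finset.sum_congr rfl fun j hj => ?_
  have hj := Finset.mem_range.1 hj
  rcases j with _ | j
  · simp
  · rw [mul_pow, mul_pow, show k - 2 = (j + 1 - 1) + (k - 1 - (j + 1)) by omega, pow_add]; ring

lemma degL_scale_eq_zero {r : ℝ} (hr : r ≠ 0) :
    degL (r * x, r * σ, t) c = 0 ↔ degL (x, σ, t) c = 0 := by
  rw [degL_apply, degL_apply, degS_scale, degEta_scale, degH_scale]
  simp [Prod.ext_iff, hr]

lemma degL_add_two_pi : degL (x, σ, t + 2 * Real.pi) c = degL (x, σ, t) c := by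
  have hS : ∀ j, solS c j (t + 2 * Real.pi) = solS c j t := fun j => by
    rw [two_mul, ← add_assoc, solS_add_pi, solS_add_pi, ← mul_assoc, neg_mul_neg, ← mul_pow]
    simp
  have hH : ∀ j, solH c j (t + 2 * Real.pi) = solH c j t := fun j => by
    rw [two_mul, ← add_assoc, solH_add_pi, solH_add_pi, ← mul_assoc, neg_mul_neg, ← mul_pow]
    simp
  have hE : ∀ j, solEta c j (t + 2 * Real.pi) = solEta c j t := fun j => by
    rw [two_mul, ← add_assoc, solEta_add_pi, solEta_add_pi, ← mul_assoc, ← mul_pow]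
    simp
  simp only [degL_apply, degS, degEta, degH, hS, hH, hE]

end Linear

section Degenerate
variable {k : ℕ} (c : Params k)

/-- At a point where the frame degenerates, the three functions vanish. -/
lemma degL_eq_zero_of_frame {x y t r : ℝ} (h : frameX c x y t = r • frameY x t) :
    degL (x, 1, t) c = 0 := by
  set S : ℂ := ∑ j ∈ Finset.range (k + 1), ((j * x ^ (j - 1) : ℝ) : ℂ) * solS c j t with hS
  set H : ℂ := ∑ j ∈ Finset.range (k + 1), ((j * x ^ (j - 1) : ℝ) : ℂ) * solH c j t with hH
  have e0 := congrArg (fun v : C3 => v 0) h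
  have e1 := congrArg (fun v : C3 => v 1) h
  have e2 := congrArg (fun v : C3 => (v 2).im) h
  have hw := exp_mul_exp_neg t
  have s0 : frameX c x y t 0 = Complex.exp (Complex.I * t) * ((S + Complex.I * conj H) / 2) := by
    simp only [hS, hH, map_sum, map_mul, Complex.conj_ofReal, Finset.mul_sum,
      ← Finset.sum_add_distrib, Finset.sum_div]
    simp [frameX, q2, sol]
    refine Finset.sum_congr rfl fun j _ => ?_
    ring
  have s1 : frameX c x y t 1 = Complex.exp (-(Complex.I * t)) * ((H - Complex.I * conj S) / 2) := by
    simp only [hS, hH, map_sum, map_mul, Complex.conj_ofReal, Finset.mul_sum,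
      ← Finset.sum_sub_distrib, Finset.sum_div]
    simp [frameX, q2, sol]
    refine Finset.sum_congr rfl fun j _ => ?_
    ring
  have s2 : (frameX c x y t 2).im = ∑ j ∈ Finset.range (k + 1), j * x ^ (j - 1) * solEta c j t := by
    simp [frameX, q2, sol, Complex.im_sum]
    refine Finset.sum_congr rfl fun j _ => ?_
    rw [← Complex.ofReal_pow, Complex.ofReal_im, Complex.ofReal_re]
    ring
  simp only [s0, s1, s2] at e0 e1 e2
  simp [frameY, q1, q2] at e0 e1 e2
  -- The first two coordinates of X = rY, freed of e^{±it}. Their real and imaginary parts give Re S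
  -- + Im H = 2r = Im H - Re S and Im S = ±Re H, so Re S = Re H = 0.
  have f0 : S + Complex.I * conj H = 2 * r := by
    linear_combination 2 * Complex.exp (-(Complex.I * t)) * e0 - (S + Complex.I * conj H - 2 * r) * hw
  have f1 : H - Complex.I * conj S = 2 * (r * Complex.I) := by
    linear_combination 2 * Complex.exp (Complex.I * t) * e1 -
      (H - Complex.I * conj S - 2 * (r * Complex.I)) * hw
  have g0 := congrArg Complex.re f0
  have g1 := congrArg Complex.im f0
  have g2 := congrArg Complex.re f1
  have g3 := congrArg Complex.im f1
  simp at g0 g1 g2 g3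
  have hdS : degS c x 1 t = S.re := by
    rw [hS, Complex.re_sum, degS]
    exact Finset.sum_congr rfl fun j _ => by rw [Complex.re_ofReal_mul, one_pow, mul_one]
  have hdH : degH c x 1 t = H.re := by
    rw [hH, Complex.re_sum, degH]
    exact Finset.sum_congr rfl fun j _ => by rw [Complex.re_ofReal_mul, one_pow, mul_one]
  -- The third coordinate of rY is real, and y q_2 is real too, so only ∂η/∂x is left in the
  -- imaginary part.
  have hdE : degEta c x 1 t = 0 := by
    rw [← e2, Finset.sum_range_succ, solEta_eq_zero c k t le_rfl, mul_zero, add_zero, degEta]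
    exact Finset.sum_congr rfl fun j _ => by rw [one_pow, mul_one]
  rw [degL_apply, hdS, hdH, hdE, Prod.mk_eq_zero, Prod.mk_eq_zero]
  exact ⟨by linarith, rfl, by linarith⟩

end Degenerate

/-! ### Generic parameters -/

section Generic
variable {k : ℕ}

/-- The parameters for which the immersion degenerates at some point, or at infinity. -/
def degenerateParams (k : ℕ) : Set (Params k) :=
  {c | ∃ q ∈ Set.Icc (-(Real.pi / 2)) (Real.pi / 2) ×ˢ Set.Icc 0 (2 * Real.pi),
    degL (Real.sin q.1, Real.cos q.1, q.2) c = 0}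

/-- The generic parameters. -/
def genericParams (k : ℕ) : Set (Params k) := {c | c.A k ≠ 0} ∩ (degenerateParams k)ᶜ

/-- It is the projection of a closed set along a compact factor; this is why the point at infinity
(θ = ±π/2) is included. -/
lemma isClosed_degenerateParams : IsClosed (degenerateParams k) := by
  set K : Set (ℝ × ℝ) := Set.Icc (-(Real.pi / 2)) (Real.pi / 2) ×ˢ Set.Icc 0 (2 * Real.pi)
  have hK : IsCompact K := isCompact_Icc.prod isCompact_Icc
  have : CompactSpace K := isCompact_iff_compactSpace.1 hK
  have hcont : Continuous fun p : K × Params k =>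
      degL (Real.sin p.1.1.1, Real.cos p.1.1.1, p.1.1.2) p.2 := by
    have h1 : Continuous fun p : K × Params k =>
        degL (k := k) (Real.sin p.1.1.1, Real.cos p.1.1.1, p.1.1.2) :=
      (contDiff_degL (n := 0)).continuous.comp (by fun_prop)
    exact h1.clm_apply continuous_snd
  have heq : degenerateParams k = Prod.snd '' {p : K × Params k |
      degL (Real.sin p.1.1.1, Real.cos p.1.1.1, p.1.1.2) p.2 = 0} := by
    ext c
    constructor
    · rintro ⟨q, hq, h⟩
      exact ⟨(⟨q, hq⟩, c), h, rfl⟩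
    · rintro ⟨⟨⟨q, hq⟩, c⟩, h, rfl⟩
      exact ⟨q, hq, h⟩
  rw [heq]
  exact isClosedMap_snd_of_compactSpace _ (isClosed_eq hcont continuous_const)

/-- The parameter `A_l` as a real linear map. -/
def paramA (l : ℕ) : Params k →L[ℝ] ℂ :=
  LinearMap.toContinuousLinearMap
    { toFun := fun c => c.A l
      map_add' := fun c c' => c.A_add c' l
      map_smul' := fun r c => by simp [Params.A_smul] }

lemma paramA_apply (l : ℕ) (c : Params k) : paramA l c = c.A l := rfl

lemma isOpen_genericParams : IsOpen (genericParams k) :=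
  (isOpen_ne_fun (paramA k).continuous continuous_const).inter
    isClosed_degenerateParams.isOpen_compl

/-- A degenerate point (x,y,t) is moved into the compact parameter set by θ = arctan x, homogeneity,
and reduction of t modulo 2π. -/
lemma injective_fderiv_of_generic {c : Params k} (hc : c ∈ genericParams k) (z : ℝ × ℝ × ℝ) :
    Function.Injective (fderiv ℝ (Phi k (sol c)) z) := by
  obtain ⟨x, y, t⟩ := z
  refine injective_fderiv_Phi c x y t fun r hr => hc.2 ?_
  have h := degL_eq_zero_of_frame c hr
  have hper : Function.Periodic (fun t => degL (x, 1, t) c) (2 * Real.pi) :=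
    fun t => degL_add_two_pi c x 1 t
  obtain ⟨t', ht', heq⟩ := hper.exists_mem_Ico₀ Real.two_pi_pos t
  refine ⟨(Real.arctan x, t'), ⟨⟨(Real.neg_pi_div_two_lt_arctan x).le,
    (Real.arctan_lt_pi_div_two x).le⟩, Set.Ico_subset_Icc_self ht'⟩, ?_⟩
  have hcos : Real.cos (Real.arctan x) ≠ 0 := (Real.cos_arctan_pos x).ne'
  have hsin : Real.sin (Real.arctan x) = Real.cos (Real.arctan x) * x := by
    rw [← Real.tan_mul_cos hcos, Real.tan_arctan]; ring
  have : degL (Real.cos (Real.arctan x) * x, Real.cos (Real.arctan x) * 1, t') c = 0 :=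
    (degL_scale_eq_zero c x 1 t' hcos).2 (heq.symm.trans h)
  rwa [mul_one, ← hsin] at this

lemma solS_top (hk : 3 ≤ k) (c : Params k) (t : ℝ) :
    solS c k t = modeF (-1) k (2 * c.A k) k t := by
  rw [solS, Finset.sum_eq_single_of_mem k (Finset.mem_Icc.2 ⟨hk, le_rfl⟩)]
  intro l hl hlk
  exact modeF_eq_zero (lt_of_le_of_ne (Finset.mem_Icc.1 hl).2 hlk) _ _

lemma solEta_top (hk : 3 ≤ k) (c : Params k) (t : ℝ) :
    solEta c (k - 1) t = modeG (-1) k (2 * c.A k) (k - 1) t := by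
  rw [solEta, Finset.sum_eq_single_of_mem k (Finset.mem_Icc.2 ⟨hk, le_rfl⟩)]
  intro l hl hlk
  have := (Finset.mem_Icc.1 hl).2
  exact modeG_eq_zero (by omega) _ _

lemma wave_eq_zero_iff {τ : ℝ} {l : ℕ} {α : ℂ} {t : ℝ} : wave τ l α t = 0 ↔ α = 0 := by
  simp [wave]

/-- Degeneration at infinity forces the leading parameter to vanish. -/
lemma A_top_eq_zero_of_degL (hk : 3 ≤ k) {c : Params k} {x t : ℝ} (hx : x ≠ 0)
    (h : degL (x, 0, t) c = 0) : c.A k = 0 := by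
  rw [degL_apply, Prod.mk_eq_zero, Prod.mk_eq_zero] at h
  have hS : degS c x 0 t = k * x ^ (k - 1) * (solS c k t).re := by
    rw [degS, Finset.sum_range_succ, Finset.sum_eq_zero]
    · simp
    · intro j hj
      have := Finset.mem_range.1 hj
      rw [zero_pow (by omega)]; ring
  have hE : degEta c x 0 t = (k - 1 : ℕ) * x ^ (k - 1 - 1) * solEta c (k - 1) t := by
    rw [degEta, Finset.sum_eq_single_of_mem (k - 1) (Finset.mem_range.2 (by omega))]
    · simp
    · intro j hj hjk
      have := Finset.mem_range.1 hj
      rw [zero_pow (by omega)]; ring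
  have hk0 : (k : ℝ) ≠ 0 := by exact_mod_cast (by omega : k ≠ 0)
  have hk1 : ((k - 1 : ℕ) : ℝ) ≠ 0 := by exact_mod_cast (by omega : k - 1 ≠ 0)
  have hkτ := (nonResonant_neg_one hk).freq_ne
  -- At infinity only the top terms survive: Re s_k and η_{k-1} are nonzero multiples of the real
  -- and imaginary parts of one wave of amplitude 2A_k.
  have hre : (wave (-1) k (2 * c.A k) t).re = 0 := by
    have := h.1
    rw [hS, solS_top hk, modeF_re, modeCoeff_self, one_mul] at this
    simpa [hk0, hx] using this
  have him : (wave (-1) k (2 * c.A k) t).im = 0 := by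
    have := h.2.1
    rw [hE, solEta_top hk, modeG, show k - 1 + 1 = k by omega, modeCoeff_self] at this
    have h1 : ((k - 1 : ℕ) : ℝ) + 1 = k := by exact_mod_cast (by omega : k - 1 + 1 = k)
    rw [h1] at this
    simpa [hk0, hk1, hx, hkτ] using this
  have := wave_eq_zero_iff.1 (Complex.ext hre him : wave (-1) k (2 * c.A k) t = 0)
  simpa using this

/-- The parameters whose only non-zero entries are `A_3` and `B_1`. -/
def lowParams (k : ℕ) (a b : ℂ) : Params k :=
  (fun l => if (l : ℕ) = 3 then a else 0, fun l => if (l : ℕ) = 1 then b else 0)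

lemma lowParams_A (hk : 3 ≤ k) (a b : ℂ) (l : ℕ) :
    (lowParams k a b).A l = if l = 3 then a else 0 := by
  unfold Params.A
  split_ifs with h h' h'
  · simp [lowParams, h']
  · simp [lowParams, h']
  · exact absurd (Finset.mem_Icc.2 ⟨h'.ge, h' ▸ hk⟩) h
  · rfl

lemma lowParams_B (hk : 3 ≤ k) (a b : ℂ) (l : ℕ) :
    (lowParams k a b).B l = if l = 1 then b else 0 := by
  unfold Params.B
  split_ifs with h h' h'
  · simp [lowParams, h']
  · simp [lowParams, h']
  · exact absurd (Finset.mem_Icc.2 ⟨h'.ge, by omega⟩) h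
  · rfl

lemma lowParams_beta (hk : 3 ≤ k) (a b : ℂ) (l : ℕ) :
    (lowParams k a b).beta l = if l = 1 then Complex.I * (2 * conj b - 3 * a) else 0 := by
  rw [Params.beta, lowParams_A hk, lowParams_B hk]
  by_cases h : l = 1
  · subst h; norm_num
  · simp [h]

lemma modeF_zero (τ : ℝ) (l j : ℕ) (t : ℝ) : modeF τ l 0 j t = 0 := by simp [modeF, wave]

lemma modeG_zero (τ : ℝ) (l j : ℕ) (t : ℝ) : modeG τ l 0 j t = 0 := by simp [modeG, wave]

lemma solS_low (hk : 3 ≤ k) (a b : ℂ) (j : ℕ) (t : ℝ) :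
    solS (lowParams k a b) j t = modeF (-1) 3 (2 * a) j t := by
  rw [solS, Finset.sum_eq_single_of_mem 3 (Finset.mem_Icc.2 ⟨le_rfl, hk⟩)]
  · rw [lowParams_A hk, if_pos rfl]
  · intro l _ hl
    rw [lowParams_A hk, if_neg hl, mul_zero, modeF_zero]

lemma solEta_low (hk : 3 ≤ k) (a b : ℂ) (j : ℕ) (t : ℝ) :
    solEta (lowParams k a b) j t = modeG (-1) 3 (2 * a) j t := by
  rw [solEta, Finset.sum_eq_single_of_mem 3 (Finset.mem_Icc.2 ⟨le_rfl, hk⟩)]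
  · rw [lowParams_A hk, if_pos rfl]
  · intro l _ hl
    rw [lowParams_A hk, if_neg hl, mul_zero, modeG_zero]

lemma solH_low (hk : 3 ≤ k) (a b : ℂ) (j : ℕ) (t : ℝ) :
    solH (lowParams k a b) j t = modeF 1 1 (Complex.I * (2 * conj b - 3 * a)) j t := by
  rw [solH, Finset.sum_eq_single_of_mem 1 (Finset.mem_Icc.2 ⟨le_rfl, by omega⟩)]
  · rw [lowParams_beta hk, if_pos rfl]
  · intro l _ hl
    rw [lowParams_beta hk, if_neg hl, modeF_zero]

lemma modeCoeff_three_one : modeCoeff (-1) 3 1 = 3 := by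
  have := modeCoeff_neg_one_two_below 1 le_rfl
  norm_num at this
  exact this

/-- The amplitudes of the two lowest modes can be prescribed. -/
lemma exists_lowParams (E F : ℂ) (t : ℝ) : ∃ a b : ℂ, wave (-1) 3 (2 * a) t = E ∧
    wave 1 1 (Complex.I * (2 * conj b - 3 * a)) t = F := by
  set w := Complex.exp (Complex.I * ((((3 : ℕ) : ℝ) + (-1) : ℝ) * t)) with hw
  set w' := Complex.exp (Complex.I * ((((1 : ℕ) : ℝ) + 1 : ℝ) * t)) with hw'
  have h1 : w ≠ 0 := Complex.exp_ne_zero _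
  have h2 : w' ≠ 0 := Complex.exp_ne_zero _
  refine ⟨E / (2 * w), conj ((3 * (E / (2 * w)) - Complex.I * (F / w')) / 2), ?_, ?_⟩
  · rw [wave, ← hw]; field_simp
  · rw [wave, ← hw', Complex.conj_conj]
    field_simp
    linear_combination (-2 * F * w) * Complex.I_sq

/-- A_3 and B_1 alone suffice: the s-mode with l = 3 contributes (3+3x²) Re w to the first equation
and -3x Im w to the second, and the h-mode with l = 1 fills the third. The factor x is why x = 0 is
excluded. -/
lemma surjective_degL (hk : 3 ≤ k) {x : ℝ} (hx : x ≠ 0) (t : ℝ) :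
    Function.Surjective (degL (k := k) (x, 1, t)) := by
  rintro ⟨r₁, r₂, r₃⟩
  obtain ⟨a, b, hE, hF⟩ := exists_lowParams
    ((r₁ / (3 + 3 * x ^ 2) : ℝ) + (-r₂ / (3 * x) : ℝ) * Complex.I) (r₃ : ℂ) t
  have hre := congrArg Complex.re hE
  have him := congrArg Complex.im hE
  simp only [Complex.add_re, Complex.add_im, Complex.re_ofReal_mul, Complex.im_ofReal_mul,
    Complex.ofReal_re, Complex.ofReal_im, Complex.I_re, Complex.I_im, mul_zero, mul_one, add_zero,
    zero_add] at hre him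
  refine ⟨lowParams k a b, ?_⟩
  rw [degL_apply]
  have hpos : 3 + 3 * x ^ 2 ≠ 0 := by positivity
  have hS : degS (lowParams k a b) x 1 t = r₁ := by
    simp only [degS, solS_low hk, one_pow, mul_one, modeF_re, hre]
    rw [← Finset.sum_subset (Finset.range_mono (show 4 ≤ k + 1 by omega))]
    · simp only [Finset.sum_range_succ, Finset.sum_range_zero, modeCoeff_self, modeCoeff_three_one,
        modeCoeff_succ_self]
      field_simp
      norm_num
      ring
    · intro j _ hj
      rw [modeCoeff_of_lt (by rw [Finset.mem_range] at hj; omega)]; ring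
  have hE : degEta (lowParams k a b) x 1 t = r₂ := by
    simp only [degEta, solEta_low hk, one_pow, mul_one, modeG, him]
    rw [← Finset.sum_subset (Finset.range_mono hk)]
    · simp only [Finset.sum_range_succ, Finset.sum_range_zero, Nat.reduceAdd, modeCoeff_self,
        modeCoeff_three_one, modeCoeff_succ_self]
      field_simp
      norm_num
      ring
    · intro j _ hj
      rw [modeCoeff_of_lt (by rw [Finset.mem_range] at hj; omega)]; ring
  have hH : degH (lowParams k a b) x 1 t = r₃ := by
    simp only [degH, solH_low hk, one_pow, mul_one, modeF_re, hF, Complex.ofReal_re]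
    rw [← Finset.sum_subset (Finset.range_mono (show 2 ≤ k + 1 by omega))]
    · simp [Finset.sum_range_succ]
    · intro j _ hj
      rw [modeCoeff_of_lt (by rw [Finset.mem_range] at hj; omega)]; ring
  rw [hS, hE, hH]

/-- The functions whose common zeros are the points with `x = 0` where the immersion
degenerates. -/
def degZero (t : ℝ) : Params k →L[ℝ] ℝ × ℝ :=
  LinearMap.toContinuousLinearMap ((solSre 1 t).prod (solHre 1 t))

lemma degZero_apply (t : ℝ) (c : Params k) : degZero t c = ((solS c 1 t).re, (solH c 1 t).re) := rfl

lemma contDiff_degZero {n : WithTop ℕ∞} : ContDiff ℝ n (degZero (k := k)) :=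
  contDiff_clm_apply_iff.2 fun c =>
    (contDiff_re (contDiff_solS c 1)).prodMk (contDiff_re (contDiff_solH c 1))

/-- At x = 0 the third equation reads η_1 = 0, which is vacuous when k = 3. It is dropped, and the
loss is made up by x no longer varying. -/
lemma surjective_degZero (hk : 3 ≤ k) (t : ℝ) : Function.Surjective (degZero (k := k) t) := by
  rintro ⟨r₁, r₂⟩
  obtain ⟨a, b, hE, hF⟩ := exists_lowParams (r₁ / 3 : ℝ) (r₂ : ℂ) t
  refine ⟨lowParams k a b, ?_⟩
  rw [degZero_apply, solS_low hk, solH_low hk, modeF_re, modeF_re, hE, hF, modeCoeff_three_one,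
    modeCoeff_self, Complex.ofReal_re, Complex.ofReal_re]
  simp [mul_div_cancel₀]

lemma degZero_eq_zero (hk : 3 ≤ k) {c : Params k} {t : ℝ} (h : degL (0, 1, t) c = 0) :
    degZero t c = 0 := by
  rw [degL_apply, Prod.mk_eq_zero, Prod.mk_eq_zero] at h
  have h1 : degS c 0 1 t = (solS c 1 t).re := by
    rw [degS, Finset.sum_eq_single_of_mem 1 (Finset.mem_range.2 (by omega))]
    · simp
    · rintro (_ | _ | j) _ hj
      · simp
      · exact absurd rfl hj
      · simp
  have h2 : degH c 0 1 t = (solH c 1 t).re := by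
    rw [degH, Finset.sum_eq_single_of_mem 1 (Finset.mem_range.2 (by omega))]
    · simp
    · rintro (_ | _ | j) _ hj
      · simp
      · exact absurd rfl hj
      · simp
  rw [degZero_apply, ← h1, ← h2, h.1, h.2.2]; rfl

lemma finrank_params (hk : 3 ≤ k) : Module.finrank ℝ (Params k) = 4 * k - 4 := by
  rw [Module.finrank_prod, Module.finrank_pi_fintype, Module.finrank_pi_fintype]
  simp only [Complex.finrank_real_complex, Finset.sum_const, Finset.card_univ, Fintype.card_coe,
    Nat.card_Icc, smul_eq_mul]
  omega

/-- According to x = tan θ, a degeneration occurs at infinity, at x = 0, or at a finite x ≠ 0; each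
case is a union of kernels of surjective maps. The variable `_t` is a dummy that gives the single
kernel A_k = 0 the form of a family. -/
lemma compl_genericParams_subset (hk : 3 ≤ k) : (genericParams k)ᶜ ⊆
    {c | ∃ _t ∈ (Set.univ : Set ℝ), paramA k c = 0} ∪
    ({c | ∃ q ∈ {q : ℝ × ℝ | q.1 ≠ 0}, degL (q.1, 1, q.2) c = 0} ∪
      {c | ∃ t ∈ (Set.univ : Set ℝ), degZero t c = 0}) := by
  intro c hc
  rw [genericParams, Set.compl_inter, compl_compl] at hc
  rcases hc with hc | ⟨⟨θ, t⟩, hq, h⟩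
  · exact Or.inl ⟨0, trivial, not_not.1 hc⟩
  · by_cases hcos : Real.cos θ = 0
    · refine Or.inl ⟨0, trivial, ?_⟩
      have hsin : Real.sin θ ≠ 0 := fun hs => by
        have := Real.sin_sq_add_cos_sq θ
        rw [hs, hcos] at this
        norm_num at this
      simp only [hcos] at h
      exact A_top_eq_zero_of_degL hk hsin h
    · have h' : degL (Real.tan θ, 1, t) c = 0 := by
        refine (degL_scale_eq_zero c (Real.tan θ) 1 t hcos).1 ?_
        rwa [mul_comm, Real.tan_mul_cos hcos, mul_one]
      by_cases hx : Real.tan θ = 0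
      · rw [hx] at h'
        exact Or.inr (Or.inr ⟨t, trivial, degZero_eq_zero hk h'⟩)
      · exact Or.inr (Or.inl ⟨(Real.tan θ, t), hx, h'⟩)

/-- In each piece the number of equations exceeds the number of variables by one: 2 against the
dummy variable, 3 against (x,t), and 2 against t. -/
lemma dimH_compl_genericParams (hk : 3 ≤ k) :
    dimH (genericParams k)ᶜ ≤ ((4 * k - 5 : ℕ) : ℝ≥0∞) := by
  refine (dimH_mono (compl_genericParams_subset hk)).trans ?_
  rw [dimH_union, dimH_union]
  refine max_le ?_ (max_le ?_ ?_)
  · refine (dimH_kernels_le (G := fun _ : ℝ => paramA (k := k) k) contDiff_const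
      (S := Set.univ) fun _ _ a => ?_).trans ?_
    · refine ⟨(fun l => if (l : ℕ) = k then a else 0, 0), ?_⟩
      rw [paramA_apply, Params.A, dif_pos (Finset.mem_Icc.2 ⟨hk, le_rfl⟩)]
      simp
    · rw [finrank_params hk, Complex.finrank_real_complex, Module.finrank_self]
      exact_mod_cast (by omega)
  · refine (dimH_kernels_le (G := fun q : ℝ × ℝ => degL (k := k) (q.1, 1, q.2))
      (contDiff_degL.comp (contDiff_fst.prodMk (contDiff_const.prodMk contDiff_snd)))
      fun q hq => surjective_degL hk hq q.2).trans ?_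
    rw [finrank_params hk]
    simp only [Module.finrank_prod, Module.finrank_self]
    exact_mod_cast (by omega)
  · refine (dimH_kernels_le (G := degZero (k := k)) contDiff_degZero
      fun t _ => surjective_degZero hk t).trans ?_
    rw [finrank_params hk]
    simp only [Module.finrank_prod, Module.finrank_self]
    exact_mod_cast (by omega)

lemma dense_genericParams (hk : 3 ≤ k) : Dense (genericParams k) := by
  rw [← compl_compl (genericParams k)]
  refine dense_compl_of_dimH_lt_finrank ((dimH_compl_genericParams hk).trans_lt ?_)
  rw [finrank_params hk]
  exact_mod_cast (by omega)

end Generic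

/-! ### The quotient ℝ³/ℤ ≅ S¹ × ℝ² and the induced map -/

section Quotient

attribute [local instance] finrank_real_complex_fact'

/-- The quotient map `ℝ³ → S¹ × ℝ²`. -/
def torusProj (z : ℝ × ℝ × ℝ) : SolidTorus :=
  (Circle.exp (2 * z.2.2), !₂[z.1 * Real.cos z.2.2 - z.2.1 * Real.sin z.2.2,
    z.1 * Real.sin z.2.2 + z.2.1 * Real.cos z.2.2])

/-- The angle near `t₀` with prescribed double. -/
def halfAngle (t₀ : ℝ) (ζ : ℂ) : ℝ :=
  t₀ + (Complex.log (ζ * (Circle.exp (-(2 * t₀)) : ℂ))).im / 2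

/-- A right inverse of the quotient map that is smooth over the circle point of angle `2 t₀`. -/
def torusSection (t₀ : ℝ) (q : ℂ × E2) : ℝ × ℝ × ℝ :=
  (q.2 0 * Real.cos (halfAngle t₀ q.1) + q.2 1 * Real.sin (halfAngle t₀ q.1),
    -(q.2 0 * Real.sin (halfAngle t₀ q.1)) + q.2 1 * Real.cos (halfAngle t₀ q.1),
    halfAngle t₀ q.1)

/-- The inclusion of the solid torus in `ℂ × ℝ²`. -/
def torusIncl (m : SolidTorus) : ℂ × E2 := ((m.1 : ℂ), m.2)

lemma contMDiff_torusIncl : ContMDiff torusModel 𝓘(ℝ, ℂ × E2) ∞ torusIncl := by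
  have h1 : ContMDiff (𝓡 1) 𝓘(ℝ, ℂ) ∞ (fun z : Circle => (z : ℂ)) := contMDiff_coe_sphere
  exact (h1.comp contMDiff_fst).prodMk_space contMDiff_snd

lemma contMDiff_torusProj : ContMDiff 𝓘(ℝ, ℝ × ℝ × ℝ) torusModel ∞ torusProj := by
  have ht : ContDiff ℝ ∞ fun z : ℝ × ℝ × ℝ => z.2.2 := contDiff_snd.comp contDiff_snd
  have hy : ContDiff ℝ ∞ fun z : ℝ × ℝ × ℝ => z.2.1 := contDiff_fst.comp contDiff_snd
  have hx : ContDiff ℝ ∞ fun z : ℝ × ℝ × ℝ => z.1 := contDiff_fst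
  refine ContMDiff.prodMk (contMDiff_circleExp.comp (contDiff_const.mul ht).contMDiff) ?_
  refine ContDiff.contMDiff (contDiff_piLp' 2 fun i => ?_)
  fin_cases i
  · exact (hx.mul (Real.contDiff_cos.comp ht)).sub (hy.mul (Real.contDiff_sin.comp ht))
  · exact (hx.mul (Real.contDiff_sin.comp ht)).add (hy.mul (Real.contDiff_cos.comp ht))

/-- Holds on the whole torus, including the branch cut where the section is discontinuous, since
`Complex.arg` is a genuine argument everywhere. -/
lemma torusProj_torusSection (t₀ : ℝ) (m : SolidTorus) :
    torusProj (torusSection t₀ (torusIncl m)) = m := by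
  obtain ⟨z, w⟩ := m
  set θ := halfAngle t₀ z with hθ
  have h1 : Circle.exp (2 * θ) = z := by
    have h2 : 2 * θ = 2 * t₀ + Complex.arg ((z * Circle.exp (-(2 * t₀)) : Circle) : ℂ) := by
      rw [hθ, halfAngle, Complex.log_im, Circle.coe_mul]; ring
    rw [h2, Circle.exp_add, Circle.exp_arg, mul_left_comm, ← Circle.exp_add, add_neg_cancel,
      Circle.exp_zero, mul_one]
  have hcs := Real.sin_sq_add_cos_sq θ
  refine Prod.ext h1 ?_
  ext i
  fin_cases i
  · change (w 0 * Real.cos θ + w 1 * Real.sin θ) * Real.cos θ -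
      (-(w 0 * Real.sin θ) + w 1 * Real.cos θ) * Real.sin θ = w 0
    linear_combination w 0 * hcs
  · change (w 0 * Real.cos θ + w 1 * Real.sin θ) * Real.sin θ +
      (-(w 0 * Real.sin θ) + w 1 * Real.cos θ) * Real.cos θ = w 1
    linear_combination w 1 * hcs

/-- For |t - t₀| < π/2 the doubled difference lies in the principal range of the argument. -/
lemma torusSection_torusProj {z : ℝ × ℝ × ℝ} {t₀ : ℝ} (h : |z.2.2 - t₀| < Real.pi / 2) :
    torusSection t₀ (torusIncl (torusProj z)) = z := by
  obtain ⟨x, y, t⟩ := z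
  rw [abs_lt] at h
  have hθ : halfAngle t₀ (Circle.exp (2 * t) : ℂ) = t := by
    rw [halfAngle, Complex.log_im, ← Circle.coe_mul, ← Circle.exp_add, Circle.arg_exp]
    · ring
    · linarith [h.1]
    · linarith [h.2]
  have hcs := Real.sin_sq_add_cos_sq t
  change (_, _, halfAngle t₀ (Circle.exp (2 * t) : ℂ)) = (x, y, t)
  rw [hθ]
  simp only [torusIncl, torusProj, hθ]
  refine Prod.ext ?_ (Prod.ext ?_ rfl)
  · change (x * Real.cos t - y * Real.sin t) * Real.cos t +
      (x * Real.sin t + y * Real.cos t) * Real.sin t = x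
    linear_combination x * hcs
  · change -((x * Real.cos t - y * Real.sin t) * Real.sin t) +
      (x * Real.sin t + y * Real.cos t) * Real.cos t = y
    linear_combination y * hcs

lemma contDiffAt_torusSection (t₀ : ℝ) (w : E2) :
    ContDiffAt ℝ ∞ (torusSection t₀) ((Circle.exp (2 * t₀) : ℂ), w) := by
  have hθ : ContDiffAt ℝ ∞ (fun q : ℂ × E2 => halfAngle t₀ q.1)
      ((Circle.exp (2 * t₀) : ℂ), w) := by
    have h1 : ((Circle.exp (2 * t₀) : ℂ) * (Circle.exp (-(2 * t₀)) : ℂ)) = 1 := by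
      rw [← Circle.coe_mul, ← Circle.exp_add, add_neg_cancel, Circle.exp_zero, Circle.coe_one]
    have h2 : ContDiffAt ℝ ∞ Complex.log
        ((Circle.exp (2 * t₀) : ℂ) * (Circle.exp (-(2 * t₀)) : ℂ)) := by
      rw [h1]
      exact (Complex.contDiffAt_log Complex.one_mem_slitPlane).restrict_scalars ℝ
    have h3 : ContDiffAt ℝ ∞ (fun q : ℂ × E2 => q.1 * (Circle.exp (-(2 * t₀)) : ℂ))
        ((Circle.exp (2 * t₀) : ℂ), w) := (contDiff_fst.mul contDiff_const).contDiffAt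
    have h4 := h2.comp ((Circle.exp (2 * t₀) : ℂ), w) h3
    exact contDiffAt_const.add
      ((Complex.imCLM.contDiff.contDiffAt.comp ((Circle.exp (2 * t₀) : ℂ), w) h4).div_const 2)
  have hc := Real.contDiff_cos.contDiffAt.comp ((Circle.exp (2 * t₀) : ℂ), w) hθ
  have hs := Real.contDiff_sin.contDiffAt.comp ((Circle.exp (2 * t₀) : ℂ), w) hθ
  have hw : ∀ i, ContDiffAt ℝ ∞ (fun q : ℂ × E2 => q.2 i) ((Circle.exp (2 * t₀) : ℂ), w) :=
    fun i => ((contDiff_piLp_apply 2 (i := i)).comp contDiff_snd).contDiffAt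
  exact (((hw 0).mul hc).add ((hw 1).mul hs)).prodMk
    ((((hw 0).mul hs).neg.add ((hw 1).mul hc)).prodMk hθ)

lemma contMDiffAt_torusSection (z : ℝ × ℝ × ℝ) :
    ContMDiffAt torusModel 𝓘(ℝ, ℝ × ℝ × ℝ) ∞ (torusSection z.2.2 ∘ torusIncl) (torusProj z) :=
  ContMDiffAt.comp (torusProj z) (contDiffAt_torusSection z.2.2 _).contMDiffAt
    contMDiff_torusIncl.contMDiffAt

lemma finrank_tangentSpace_torus (m : SolidTorus) :
    Module.finrank ℝ (TangentSpace torusModel m) = 3 := by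
  change Module.finrank ℝ (EuclideanSpace ℝ (Fin 1) × E2) = 3
  simp

lemma bijective_mfderiv_torusProj (z : ℝ × ℝ × ℝ) :
    Function.Bijective (mfderiv 𝓘(ℝ, ℝ × ℝ × ℝ) torusModel torusProj z) := by
  have hne : (∞ : WithTop ℕ∞) ≠ 0 := by simp
  have hP := contMDiff_torusProj.mdifferentiable hne z
  have hS := (contMDiffAt_torusSection z).mdifferentiableAt hne
  have hcomp := mfderiv_comp z hS hP
  have heq : (torusSection z.2.2 ∘ torusIncl) ∘ torusProj =ᶠ[nhds z] id := by
    have : {z' : ℝ × ℝ × ℝ | |z'.2.2 - z.2.2| < Real.pi / 2} ∈ nhds z := by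
      refine IsOpen.mem_nhds (isOpen_lt (by fun_prop) continuous_const) ?_
      simp [Real.pi_pos]
    filter_upwards [this] with z' hz'
    exact torusSection_torusProj hz'
  rw [heq.mfderiv_eq, mfderiv_id] at hcomp
  have hinj : Function.Injective (mfderiv 𝓘(ℝ, ℝ × ℝ × ℝ) torusModel torusProj z) := by
    intro a b hab
    have ha := congrArg (fun f => f a) hcomp
    have hb := congrArg (fun f => f b) hcomp
    change a = mfderiv torusModel 𝓘(ℝ, ℝ × ℝ × ℝ) (torusSection z.2.2 ∘ torusIncl) (torusProj z)
      (mfderiv 𝓘(ℝ, ℝ × ℝ × ℝ) torusModel torusProj z a) at ha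
    change b = mfderiv torusModel 𝓘(ℝ, ℝ × ℝ × ℝ) (torusSection z.2.2 ∘ torusIncl) (torusProj z)
      (mfderiv 𝓘(ℝ, ℝ × ℝ × ℝ) torusModel torusProj z b) at hb
    rw [ha, hb, hab]
  refine ⟨hinj, ?_⟩
  let D : (ℝ × ℝ × ℝ) →ₗ[ℝ] (EuclideanSpace ℝ (Fin 1) × E2) :=
    (mfderiv 𝓘(ℝ, ℝ × ℝ × ℝ) torusModel torusProj z).toLinearMap
  exact (LinearMap.injective_iff_surjective_of_finrank_eq_finrank (f := D) (by simp)).1 hinj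

/-- Shifting t by nπ fixes e^{2it} and multiplies cos t and sin t by (-1)^n, which cancels the signs
put on x and y. -/
lemma torusProj_deck (n : ℤ) (z : ℝ × ℝ × ℝ) : torusProj (deck n z) = torusProj z := by
  obtain ⟨x, y, t⟩ := z
  have hsq : ((-1 : ℝ) ^ n) * (-1) ^ n = 1 := by
    rw [← mul_zpow]; simp
  refine Prod.ext ?_ ?_
  · change Circle.exp (2 * (t + n * Real.pi)) = Circle.exp (2 * t)
    rw [Circle.exp_eq_exp]
    exact ⟨n, by ring⟩
  · ext i
    fin_cases i
    · change (-1) ^ n * x * Real.cos (t + n * Real.pi) -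
        (-1) ^ n * y * Real.sin (t + n * Real.pi) = x * Real.cos t - y * Real.sin t
      rw [Real.cos_add_int_mul_pi, Real.sin_add_int_mul_pi]
      linear_combination (x * Real.cos t - y * Real.sin t) * hsq
    · change (-1) ^ n * x * Real.sin (t + n * Real.pi) +
        (-1) ^ n * y * Real.cos (t + n * Real.pi) = x * Real.sin t + y * Real.cos t
      rw [Real.cos_add_int_mul_pi, Real.sin_add_int_mul_pi]
      linear_combination (x * Real.sin t + y * Real.cos t) * hsq

lemma exists_deck_of_torusProj_eq {z w : ℝ × ℝ × ℝ} (h : torusProj z = torusProj w) :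
    ∃ n : ℤ, w = deck n z := by
  have h1 : Circle.exp (2 * w.2.2) = Circle.exp (2 * z.2.2) := (congrArg Prod.fst h).symm
  obtain ⟨n, hn⟩ := Circle.exp_eq_exp.1 h1
  have ht : (deck n z).2.2 = w.2.2 := by
    change z.2.2 + n * Real.pi = w.2.2
    linarith
  refine ⟨n, ?_⟩
  -- The integer n makes the last coordinates equal, and a local section centred there then recovers
  -- both points from their common image.
  have h2 : torusProj w = torusProj (deck n z) := by rw [torusProj_deck, h]
  have hpi : |w.2.2 - w.2.2| < Real.pi / 2 := by simp [Real.pi_pos]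
  rw [← torusSection_torusProj hpi, h2, torusSection_torusProj (by rw [ht]; exact hpi)]

lemma isQuotientByDeck_torusProj : IsQuotientByDeck torusProj where
  smooth := contMDiff_torusProj
  bijective_mfderiv := bijective_mfderiv_torusProj
  surjective m := ⟨_, torusProj_torusSection 0 m⟩
  fibres z w := ⟨exists_deck_of_torusProj_eq, by rintro ⟨n, rfl⟩; exact (torusProj_deck n z).symm⟩

lemma Phi_deck {k : ℕ} (c : Params k) (n : ℤ) (z : ℝ × ℝ × ℝ) :
    Phi k (sol c) (deck n z) = Phi k (sol c) z := by
  have hstep : ∀ z : ℝ × ℝ × ℝ, Phi k (sol c) (deck 1 z) = Phi k (sol c) z := by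
    rintro ⟨x, y, t⟩
    have := Phi_add_pi c t (-x) (-y)
    rw [neg_neg, neg_neg] at this
    simpa [deck] using this
  have hadd : ∀ (n : ℤ) (z : ℝ × ℝ × ℝ), deck (n + 1) z = deck 1 (deck n z) := by
    intro n z
    simp only [deck, zpow_add₀ (show (-1 : ℝ) ≠ 0 by norm_num), zpow_one]
    refine Prod.ext (by simp) (Prod.ext (by simp) ?_)
    push_cast; ring
  induction n using Int.induction_on with
  | zero => simp [deck]
  | succ i ih => rw [hadd, hstep, ih]
  | pred i ih =>
    rw [← ih, ← sub_add_cancel (-(i : ℤ)) 1, hadd (-(i : ℤ) - 1) z, hstep]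
    simp

/-- The map induced by `Φ` on the quotient. -/
def torusMap {k : ℕ} (c : Params k) (m : SolidTorus) : C3 :=
  Phi k (sol c) (torusSection 0 (torusIncl m))

variable {k : ℕ} (c : Params k)

lemma torusMap_torusProj (z : ℝ × ℝ × ℝ) : torusMap c (torusProj z) = Phi k (sol c) z := by
  obtain ⟨n, hn⟩ := exists_deck_of_torusProj_eq (torusProj_torusSection 0 (torusProj z)).symm
  rw [torusMap, hn, Phi_deck]

/-- By invariance under ℤ the induced map does not depend on the branch, so near any point it can be
computed with a smooth section. -/
lemma torusMap_eq_comp (t₀ : ℝ) :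
    torusMap c = Phi k (sol c) ∘ (torusSection t₀ ∘ torusIncl) := by
  funext m
  conv_lhs => rw [← torusProj_torusSection t₀ m]
  exact torusMap_torusProj c _

lemma contMDiff_torusMap : ContMDiff torusModel 𝓘(ℝ, C3) ∞ (torusMap c) := by
  intro m
  obtain ⟨z, rfl⟩ := isQuotientByDeck_torusProj.surjective m
  rw [torusMap_eq_comp c z.2.2]
  exact (contDiff_Phi c).contMDiff.contMDiffAt.comp _ (contMDiffAt_torusSection z)

lemma range_torusMap : Set.range (torusMap c) = Set.range (Phi k (sol c)) := by
  rw [← isQuotientByDeck_torusProj.surjective.range_comp]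
  congr 1
  funext z
  exact torusMap_torusProj c z

lemma isSLImmersion_torusMap (h : ∀ z, Function.Injective (fderiv ℝ (Phi k (sol c)) z)) :
    IsSLImmersion (torusMap c) := by
  have hne : (∞ : WithTop ℕ∞) ≠ 0 := by simp
  refine ⟨contMDiff_torusMap c, fun m => ?_⟩
  obtain ⟨z, rfl⟩ := isQuotientByDeck_torusProj.surjective m
  have hcomp : ∀ v, mfderiv 𝓘(ℝ, ℝ × ℝ × ℝ) 𝓘(ℝ, C3) (torusMap c ∘ torusProj) z v =
      mfderiv torusModel 𝓘(ℝ, C3) (torusMap c) (torusProj z)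
        (mfderiv 𝓘(ℝ, ℝ × ℝ × ℝ) torusModel torusProj z v) := fun v =>
    mfderiv_comp_apply z ((contMDiff_torusMap c).mdifferentiable hne (torusProj z))
      (contMDiff_torusProj.mdifferentiable hne z) v
  have heq : torusMap c ∘ torusProj = Phi k (sol c) := funext (torusMap_torusProj c)
  rw [heq, mfderiv_eq_fderiv] at hcomp
  have hsurj := (bijective_mfderiv_torusProj z).2
  have hrank := finrank_tangentSpace_torus (torusProj z)
  have hlin : IsLinearMap ℝ (mfderiv torusModel 𝓘(ℝ, C3) (torusMap c) (torusProj z)) :=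
    ⟨map_add _, map_smul _⟩
  generalize mfderiv torusModel 𝓘(ℝ, C3) (torusMap c) (torusProj z) = T at hcomp hlin ⊢
  generalize mfderiv 𝓘(ℝ, ℝ × ℝ × ℝ) torusModel torusProj z = D at hcomp hsurj
  exact (isSLTangent_fderiv_Phi c z (h z)).of_comp hlin hrank hsurj fun v => (hcomp v).symm

end Quotient

/-! ### Properness -/

section Proper
variable {k : ℕ} (c : Params k)

/-- The top component s_k is a pure wave of modulus 2|A_k|, and is recovered from the first two
coordinates of p_k with coefficients of modulus one. -/
lemma norm_A_top_le (hk : 3 ≤ k) (t : ℝ) : ‖c.A k‖ ≤ ‖sol c k t‖ := by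
  have hS : ‖solS c k t‖ = 2 * ‖c.A k‖ := by
    have hne : ((k : ℝ) + -1) ≠ 0 := (nonResonant_neg_one hk).freq_ne
    have h1 : solS c k t = wave (-1) k (2 * c.A k) t := by
      rw [solS_top hk, modeF, modeCoeff_self, div_self hne, one_mul, Complex.ofReal_one, one_mul,
        mul_comm Complex.I, Complex.re_add_im]
    rw [h1, wave, norm_mul, mul_comm Complex.I, ← Complex.ofReal_mul, Complex.norm_exp_ofReal_mul_I]
    simp
  have h2 : solS c k t = Complex.exp (-(Complex.I * t)) * sol c k t 0 -
      Complex.I * conj (Complex.exp (Complex.I * t) * sol c k t 1) := by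
    have hw := exp_mul_exp_neg t
    have hc2 : conj (2 : ℂ) = 2 := Complex.conj_ofNat 2
    simp only [map_mul, conj_exp_I_mul]
    simp [sol, conj_exp_neg_I_mul, hc2]
    linear_combination (-(solS c k t + Complex.I * conj (solH c k t)) / 2 +
      Complex.I * (conj (solH c k t) + Complex.I * solS c k t) / 2) * hw +
      (solS c k t / 2) * Complex.I_mul_I
  have n0 : ‖Complex.exp (-(Complex.I * t))‖ = 1 := by
    rw [show -(Complex.I * (t : ℂ)) = ((-t : ℝ) : ℂ) * Complex.I by push_cast; ring,
      Complex.norm_exp_ofReal_mul_I]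
  have n1 : ‖Complex.exp (Complex.I * t)‖ = 1 := by
    rw [mul_comm, Complex.norm_exp_ofReal_mul_I]
  have h3 : ‖solS c k t‖ ≤ ‖sol c k t 0‖ + ‖sol c k t 1‖ := by
    rw [h2]
    refine (norm_sub_le _ _).trans_eq ?_
    rw [norm_mul, norm_mul, n0, RCLike.norm_conj, norm_mul, n1, Complex.norm_I, one_mul, one_mul,
      one_mul]
  have h4 := PiLp.norm_apply_le (sol c k t) 0
  have h5 := PiLp.norm_apply_le (sol c k t) 1
  linarith

lemma exists_norm_sol_le : ∃ C : ℝ, 0 ≤ C ∧ ∀ j ≤ k, ∀ t, ‖sol c j t‖ ≤ C := by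
  have h : ∀ j, ∃ C : ℝ, ∀ t, ‖sol c j t‖ ≤ C := fun j => by
    have hper : Function.Periodic (fun t => ‖sol c j t‖) Real.pi := fun t => by
      simp [sol_add_pi, norm_smul]
    obtain ⟨C, hC⟩ := (hper.compact_of_continuous Real.pi_ne_zero
      (contDiff_sol c j (n := 0)).continuous.norm).bddAbove
    exact ⟨C, fun t => hC ⟨t, rfl⟩⟩
  choose C hC using h
  refine ⟨∑ j ∈ Finset.range (k + 1), |C j|, Finset.sum_nonneg fun _ _ => abs_nonneg _,
    fun j hj t => ?_⟩
  refine ((hC j t).trans (le_abs_self _)).trans ?_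
  exact Finset.single_le_sum (f := fun j => |C j|) (fun _ _ => abs_nonneg _)
    (Finset.mem_range.2 (Nat.lt_succ_of_le hj))

lemma norm_q1_zero (t : ℝ) : ‖q1 t 0‖ = 1 := by
  change ‖Complex.exp (Complex.I * t)‖ = 1
  rw [mul_comm, Complex.norm_exp_ofReal_mul_I]

lemma norm_q1_le (t : ℝ) : ‖q1 t‖ ≤ 2 := by
  rw [EuclideanSpace.norm_eq, Fin.sum_univ_three, norm_q1_zero]
  have h1 : ‖q1 t 1‖ = 1 := by
    change ‖Complex.I * Complex.exp (-(Complex.I * t))‖ = 1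
    rw [norm_mul, Complex.norm_I, one_mul,
      show -(Complex.I * (t : ℂ)) = ((-t : ℝ) : ℂ) * Complex.I by push_cast; ring,
      Complex.norm_exp_ofReal_mul_I]
  have h2 : ‖q1 t 2‖ = 0 := by simp [q1]
  rw [h1, h2, Real.sqrt_le_left (by norm_num)]
  norm_num

lemma norm_q2 (t : ℝ) : ‖q2 t‖ = 1 := by
  simp [EuclideanSpace.norm_eq, Fin.sum_univ_three, q2]

/-- On the preimage of a bounded set, `x` and `y` are bounded. -/
lemma exists_bound_of_norm_Phi_le (hk : 3 ≤ k) (hA : c.A k ≠ 0) {R : ℝ} (hR : 0 ≤ R) :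
    ∃ M : ℝ, ∀ x y t : ℝ, ‖Phi k (sol c) (x, y, t)‖ ≤ R → |x| ≤ M ∧ |y| ≤ M := by
  obtain ⟨C, hC0, hC⟩ := exists_norm_sol_le c
  have hA' : 0 < ‖c.A k‖ := norm_pos_iff.2 hA
  set D := R + k * C with hD
  have hD0 : 0 ≤ D := by positivity
  -- With X = |x|^{k-1} and |x| ≥ 1, the 4 collects D X from Φ and the terms below x^k, 2 D X from y
  -- q_1 (as ‖q_1‖ ≤ 2), and D X from xy q_2.
  set M₁ := max 1 (4 * D / ‖c.A k‖) with hM₁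
  have hM1 : 1 ≤ M₁ := le_max_left _ _
  have hx : ∀ x y t : ℝ, ‖Phi k (sol c) (x, y, t)‖ ≤ R → |x| ≤ M₁ := by
    intro x y t hΦ
    rcases le_total |x| 1 with hx1 | hx1
    · exact hx1.trans hM1
    set X := |x| ^ (k - 1) with hX
    have hX1 : 1 ≤ X := one_le_pow₀ hx1
    have hpow : ∀ j ∈ Finset.range k, |x| ^ j ≤ X := fun j hj =>
      pow_le_pow_right₀ hx1 (by have := Finset.mem_range.1 hj; omega)
    have hsum : ∀ f : ℕ → ℝ, (∀ j ∈ Finset.range k, f j ≤ |x| ^ j * C) →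
        ∑ j ∈ Finset.range k, f j ≤ k * C * X := fun f hf => by
      calc ∑ j ∈ Finset.range k, f j ≤ ∑ _j ∈ Finset.range k, C * X :=
            Finset.sum_le_sum fun j hj => (hf j hj).trans (by
              rw [mul_comm]; exact mul_le_mul_of_nonneg_left (hpow j hj) hC0)
        _ = k * C * X := by rw [Finset.sum_const, Finset.card_range, nsmul_eq_mul]; ring
    have hRD : R + k * C * X ≤ D * X := by
      rw [hD]; nlinarith
    -- The third coordinate of p_k vanishes, so there xy is balanced only by Φ and powers of x below
    -- k; dividing by |x| ≥ 1 then bounds y as well.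
    have hxy : |x * y| ≤ D * X := by
      have e : ((x * y : ℝ) : ℂ) = Phi k (sol c) (x, y, t) 2 -
          ∑ j ∈ Finset.range k, (x ^ j : ℝ) * sol c j t 2 := by
        have htop : sol c k t 2 = 0 := by
          simp [sol, solRho_eq_zero, solEta_eq_zero]
        simp [Phi, q1, q2, Finset.sum_range_succ, htop]
      rw [← Real.norm_eq_abs, ← Complex.norm_real, e]
      refine (norm_sub_le _ _).trans (le_trans (add_le_add ((PiLp.norm_apply_le _ 2).trans hΦ)
        ((norm_sum_le _ _).trans (hsum _ fun j hj => ?_))) hRD)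
      rw [norm_mul, Complex.norm_real, norm_pow, Real.norm_eq_abs]
      exact mul_le_mul_of_nonneg_left ((PiLp.norm_apply_le _ 2).trans
        (hC j (Finset.mem_range.1 hj).le t)) (by positivity)
    have hy : |y| ≤ D * X := by
      rw [abs_mul] at hxy
      nlinarith [abs_nonneg y]
    have hmain : |x| ^ k * ‖sol c k t‖ ≤ 4 * D * X := by
      have e : x ^ k • sol c k t = Phi k (sol c) (x, y, t) -
          (∑ j ∈ Finset.range k, x ^ j • sol c j t) - y • q1 t - (x * y) • q2 t := by
        simp only [Phi, Finset.sum_range_succ]; abel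
      have h1 : ‖x ^ k • sol c k t‖ = |x| ^ k * ‖sol c k t‖ := by
        rw [norm_smul, norm_pow, Real.norm_eq_abs]
      rw [← h1, e]
      have h2 : ‖∑ j ∈ Finset.range k, x ^ j • sol c j t‖ ≤ k * C * X := by
        refine (norm_sum_le _ _).trans (hsum _ fun j hj => ?_)
        rw [norm_smul, norm_pow, Real.norm_eq_abs]
        exact mul_le_mul_of_nonneg_left (hC j (Finset.mem_range.1 hj).le t) (by positivity)
      have h3 : ‖y • q1 t‖ ≤ D * X * 2 := by
        rw [norm_smul, Real.norm_eq_abs]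
        exact mul_le_mul hy (norm_q1_le t) (norm_nonneg _) (by positivity)
      have h4 : ‖(x * y) • q2 t‖ ≤ D * X := by
        rw [norm_smul, Real.norm_eq_abs, norm_q2, mul_one]; exact hxy
      refine (norm_sub_le _ _).trans ?_
      refine (add_le_add ((norm_sub_le _ _).trans (add_le_add (norm_sub_le _ _) le_rfl))
        le_rfl).trans ?_
      linarith
    have hlow := norm_A_top_le c hk t
    have hXk : |x| ^ k = |x| * X := by
      rw [hX, ← pow_succ']; congr 1; omega
    have : |x| * ‖c.A k‖ ≤ 4 * D := by
      have h5 : |x| * ‖c.A k‖ * X ≤ 4 * D * X := by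
        refine le_trans ?_ hmain
        rw [hXk, mul_right_comm]
        exact mul_le_mul_of_nonneg_left hlow (by positivity)
      exact le_of_mul_le_mul_right h5 (by linarith)
    exact ((le_div_iff₀ hA').2 this).trans (le_max_right _ _)
  refine ⟨max M₁ (R + ∑ j ∈ Finset.range (k + 1), M₁ ^ j * C), fun x y t hΦ =>
    ⟨(hx x y t hΦ).trans (le_max_left _ _), le_trans ?_ (le_max_right _ _)⟩⟩
  have hxM := hx x y t hΦ
  -- With x bounded, the first coordinate bounds y, because the first coordinate of q_1 has modulus
  -- one and that of q_2 is zero.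
  have e : (y : ℂ) * q1 t 0 = Phi k (sol c) (x, y, t) 0 -
      ∑ j ∈ Finset.range (k + 1), (x ^ j : ℝ) * sol c j t 0 := by
    simp [Phi, q2]
  have h1 : |y| = ‖(y : ℂ) * q1 t 0‖ := by
    rw [norm_mul, norm_q1_zero, mul_one, Complex.norm_real, Real.norm_eq_abs]
  rw [h1, e]
  refine (norm_sub_le _ _).trans (add_le_add ((PiLp.norm_apply_le _ 0).trans hΦ)
    ((norm_sum_le _ _).trans (Finset.sum_le_sum fun j hj => ?_)))
  rw [norm_mul, Complex.norm_real, norm_pow, Real.norm_eq_abs]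
  exact mul_le_mul (pow_le_pow_left₀ (abs_nonneg x) hxM j) ((PiLp.norm_apply_le _ 0).trans
    (hC j (Nat.lt_succ_iff.1 (Finset.mem_range.1 hj)) t)) (norm_nonneg _) (by positivity)

/-- The circle factor is compact and the projection rotates (x,y), so bounds on x and y are enough.
-/
lemma isProperMap_torusMap (hk : 3 ≤ k) (hA : c.A k ≠ 0) : IsProperMap (torusMap c) := by
  have hcont : Continuous (torusMap c) := (contMDiff_torusMap c).continuous
  refine isProperMap_iff_isCompact_preimage.2 ⟨hcont, fun K hK => ?_⟩
  obtain ⟨R, hR⟩ := hK.isBounded.subset_closedBall 0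
  obtain ⟨M, hM⟩ := exists_bound_of_norm_Phi_le c hk hA (le_max_right R 0)
  have hcompact : IsCompact (Set.univ ×ˢ Metric.closedBall 0 (M + M) : Set SolidTorus) :=
    isCompact_univ.prod (isCompact_closedBall _ _)
  refine hcompact.of_isClosed_subset (hK.isClosed.preimage hcont) fun m hm => ?_
  obtain ⟨⟨x, y, t⟩, rfl⟩ := isQuotientByDeck_torusProj.surjective m
  have hmem := hR hm
  rw [torusMap_torusProj, mem_closedBall_zero_iff] at hmem
  obtain ⟨hx, hy⟩ := hM x y t (hmem.trans (le_max_left _ _))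
  refine ⟨trivial, mem_closedBall_zero_iff.2 ?_⟩
  have hM0 : 0 ≤ M := (abs_nonneg x).trans hx
  rw [EuclideanSpace.norm_eq, Real.sqrt_le_left (by positivity), Fin.sum_univ_two]
  have e0 : (torusProj (x, y, t)).2 0 = x * Real.cos t - y * Real.sin t := rfl
  have e1 : (torusProj (x, y, t)).2 1 = x * Real.sin t + y * Real.cos t := rfl
  rw [e0, e1, Real.norm_eq_abs, Real.norm_eq_abs, sq_abs, sq_abs]
  have hcs := Real.sin_sq_add_cos_sq t
  have hx2 : x ^ 2 ≤ M ^ 2 := sq_le_sq' (abs_le.1 hx).1 (abs_le.1 hx).2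
  have hy2 : y ^ 2 ≤ M ^ 2 := sq_le_sq' (abs_le.1 hy).1 (abs_le.1 hy).2
  calc _ = (x ^ 2 + y ^ 2) * (Real.sin t ^ 2 + Real.cos t ^ 2) := by ring
    _ ≤ (M + M) ^ 2 := by rw [hcs]; nlinarith

end Proper
end SLFamily
end

theorem theorem12p7 (k : ℕ) (hk : 3 ≤ k) :
    -- the construction gives one solution for each choice of the parameters
    (∀ c : SLFamily.Params k, ∃! p : ℕ → ℝ → SLFamily.C3, SLFamily.IsMember k c p) ∧
    -- every member is periodic, and special Lagrangian where nonsingular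
    (∀ (c : SLFamily.Params k) (p : ℕ → ℝ → SLFamily.C3), SLFamily.IsMember k c p →
      ContDiff ℝ ∞ (SLFamily.Phi k p) ∧
      (∀ x y t : ℝ, SLFamily.Phi k p (x, y, t + 2 * Real.pi) = SLFamily.Phi k p (x, y, t)) ∧
      (∀ x y t : ℝ, SLFamily.Phi k p (x, y, t + Real.pi) = SLFamily.Phi k p (-x, -y, t)) ∧
      Dense {z : ℝ × ℝ × ℝ | Function.Injective (fderiv ℝ (SLFamily.Phi k p) z)} ∧
      (∀ z : ℝ × ℝ × ℝ, Function.Injective (fderiv ℝ (SLFamily.Phi k p) z) →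
        SLFamily.IsSLTangent (fderiv ℝ (SLFamily.Phi k p) z))) ∧
    -- the generic member
    (∃ proj : ℝ × ℝ × ℝ → SLFamily.SolidTorus, SLFamily.IsQuotientByDeck proj ∧
      ∃ U : Set (SLFamily.Params k), IsOpen U ∧ Dense U ∧
        dimH Uᶜ ≤ ((4 * k - 5 : ℕ) : ℝ≥0∞) ∧
        ∀ c ∈ U, ∀ p : ℕ → ℝ → SLFamily.C3, SLFamily.IsMember k c p →
          IsClosed (Set.range (SLFamily.Phi k p)) ∧
          ∃ F : SLFamily.SolidTorus → SLFamily.C3,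
            (∀ z, F (proj z) = SLFamily.Phi k p z) ∧
            Set.range F = Set.range (SLFamily.Phi k p) ∧
            IsProperMap F ∧ SLFamily.IsSLImmersion F) := by
  open SLFamily in
  have hk1 : 1 ≤ k := by omega
  refine ⟨existsUnique_isMember hk1, fun c p hp => ?_,
    torusProj, isQuotientByDeck_torusProj, genericParams k, isOpen_genericParams,
    dense_genericParams hk, dimH_compl_genericParams hk, fun c hc p hp => ?_⟩
  -- Uniqueness reduces every assertion about a member to the explicit solution.
  · obtain rfl : p = sol c := hp.unique hk1 (isMember_sol c)
    exact ⟨contDiff_Phi c, fun x y t => Phi_add_two_pi c t x y, fun x y t => Phi_add_pi c t x y,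
      dense_injective_fderiv_Phi c, isSLTangent_fderiv_Phi c⟩
  · obtain rfl : p = sol c := hp.unique hk1 (isMember_sol c)
    have hF := isProperMap_torusMap c hk hc.1
    refine ⟨?_, torusMap c, torusMap_torusProj c, range_torusMap c, hF,
      isSLImmersion_torusMap c (injective_fderiv_of_generic hc)⟩
    rw [← range_torusMap]
    exact hF.isClosedMap.isClosed_range
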